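/- Let $n\ge 1$ and $I\subseteq\{1,\dots,n\}$. Let $Q_{n,I}$ be the quiver with vertices $1,\dots,n$, one loop at each vertex $v\notin I$, and for each $1\le v<n$ one arrow $v\to v+1$ and one arrow $v+1\to v$. Label from left to right the loops and the rightward arrows as $a_1,\dots,a_m$ with $m=2n-1-|I|$ (the loop at $v$, if present, comes after the arrow $v-1\to v$ and before the arrow $v\to v+1$). If $a_i$ is a loop at $v$, let $b_i=e_v$ be the lazy path at $v$; if $a_i\colon v\to v+1$, let $b_i$ be the arrow $v+1\to v$. Composing paths from left to right, set $\mathsf x_i=a_ib_i$ and $\mathsf x_i'=b_ia_i$. Let $\mathbb C\langle\langle Q_{n,I}\rangle\rangle$ be the complete path algebra (possibly infinite linear combinations of paths), and $\mathfrak m$ the ideal generated by the arrows. A potential is a possibly infinite linear combination of cyclic paths. Two potentials are cyclically equivalent, written $f\sim g$, if $f-g$ lies in the $\mathfrak m$-adic closure of the span of all commutators $pq-qp$. For a potential $f$ let $V(f)$ be the span of all cycles cyclically equivalent to a cycle that occurs in $f$ with non-zero coefficient; say that $f$ contains $g$ if $f\sim\lambda g+h$ for some $0\ne\lambda\in\mathbb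 C$ and some potential $h$ with $V(\lambda g)\cap V(h)=0$. A potential is reduced if its component of path length two is zero. The degree of a cycle is the number of arrows $a_1,\dots,a_m$ occurring in it, counted with multiplicity. A reduced Type $A$ potential on $Q_{n,I}$ is a reduced potential all of whose terms have degree at least $2$ and which contains $\mathsf x_i'\mathsf x_{i+1}$ for every $1\le i\le m-1$. Theorem. For every reduced Type $A$ potential $f$ on $Q_{n,I}$ there are a $\mathbb C$-algebra automorphism $\rho$ of $\mathbb C\langle\langle Q_{n,I}\rangle\rangle$ fixing every lazy path $e_v$, and a reduced potential $f'$ with $$f'\sim\sum_{i=1}^{m-1}\mathsf x_i'\mathsf x_{i+1}+\sum_{i=1}^{m}\sum_{j=2}^{\infty}\kappa_{ij}\mathsf x_i^{\,j}\qquad\text{for some }\kappa_{ij}\in\mathbb C,$$ such that $\rho(f)\sim f'$. That is, $f$ is right-equivalent to a reduced monomialized Type $A$ potential. -/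

import Mathlib

/-! ### The complete path algebra of a quiver

Paths are composed from left to right: the product of the path `p : i → j` and the path
`q : j → l` is `p.comp q : i → l`, and products of non-composable paths are zero. -/

/-- Elements of the complete path algebra `k⟨⟨Q⟩⟩`: arbitrary (possibly infinite) `k`-linear
combinations of paths. The coefficient of the path `p : i → j` in `f` is `f i j p`. -/
def CompletePathAlgebra (k : Type*) (V : Type*) [Quiver V] : Type _ :=
  ∀ i j : V, Quiver.Path i j → k

namespace CompletePathAlgebra

/-- All the ways to write a path as a composite of two paths `i → l` and `l → j`. -/
def splits {V : Type*} [Quiver V] {i : V} :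
    ∀ {j : V}, Quiver.Path i j → List (Σ l : V, Quiver.Path i l × Quiver.Path l j)
  | _, Quiver.Path.nil => [⟨i, Quiver.Path.nil, Quiver.Path.nil⟩]
  | _, Quiver.Path.cons p a =>
      (splits p).map (fun s => ⟨s.1, s.2.1, s.2.2.cons a⟩) ++ [⟨_, p.cons a, Quiver.Path.nil⟩]

theorem mem_splits {V : Type*} [Quiver V] {i j : V} (p : Quiver.Path i j)
    (s : Σ l : V, Quiver.Path i l × Quiver.Path l j) : s ∈ splits p ↔ s.2.1.comp s.2.2 = p := by
  induction p with
  | nil =>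
    obtain ⟨l, q, r⟩ := s
    constructor
    · intro h
      simp only [splits, List.mem_singleton] at h
      cases h
      rfl
    · intro h
      simp only at q r h
      cases r with
      | nil =>
        simp only [Quiver.Path.comp_nil] at h
        subst h
        simp [splits]
      | cons r a => cases h
  | cons p a ih =>
    obtain ⟨l, q, r⟩ := s
    constructor
    · intro h
      simp only [splits, List.mem_append, List.mem_map, List.mem_singleton] at h
      rcases h with ⟨t, ht, h⟩ | h
      · cases h
        simp only [Quiver.Path.comp_cons, (ih t).1 ht]
      · cases h
        rfl
    · intro h
      simp only [splits, List.mem_append, List.mem_map, List.mem_singleton]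
      cases r with
      | nil =>
        right
        simp only [Quiver.Path.comp_nil] at h
        subst h
        rfl
      | cons r b =>
        left
        simp only [Quiver.Path.comp_cons, Quiver.Path.cons.injEq] at h
        obtain ⟨rfl, h, hb⟩ := h
        cases hb
        exact ⟨⟨l, q, r⟩, (ih _).2 (eq_of_heq h), rfl⟩

section Algebra

variable {k : Type*} {V : Type*} [Quiver V]

@[ext]
theorem ext {f g : CompletePathAlgebra k V} (h : ∀ i j (p : Quiver.Path i j), f i j p = g i j p) :
    f = g := by
  funext i j p
  exact h i j p

instance [AddCommGroup k] : AddCommGroup (CompletePathAlgebra k V) :=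
  inferInstanceAs (AddCommGroup (∀ i j : V, Quiver.Path i j → k))

instance [CommRing k] : Module k (CompletePathAlgebra k V) :=
  inferInstanceAs (Module k (∀ i j : V, Quiver.Path i j → k))

variable [CommRing k]

@[simp] theorem add_coeff (f g : CompletePathAlgebra k V) {i j : V} (p : Quiver.Path i j) :
    (f + g) i j p = f i j p + g i j p := rfl

@[simp] theorem zero_coeff {i j : V} (p : Quiver.Path i j) :
    (0 : CompletePathAlgebra k V) i j p = 0 := rfl

@[simp] theorem smul_coeff (c : k) (f : CompletePathAlgebra k V) {i j : V} (p : Quiver.Path i j) :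
    (c • f) i j p = c * f i j p := rfl

/-- The unit is the sum of all lazy paths. -/
instance : One (CompletePathAlgebra k V) :=
  ⟨fun _ _ p => if p.length = 0 then 1 else 0⟩

/-- `(f * g)(p) = ∑ f(q) g(r)`, over all factorisations `p = q r`. -/
instance : Mul (CompletePathAlgebra k V) :=
  ⟨fun f g i j p => ((splits p).map (fun s => f i s.1 s.2.1 * g s.1 j s.2.2)).sum⟩

theorem one_coeff {i j : V} (p : Quiver.Path i j) :
    (1 : CompletePathAlgebra k V) i j p = if p.length = 0 then 1 else 0 := rfl

theorem mul_coeff (f g : CompletePathAlgebra k V) {i j : V} (p : Quiver.Path i j) :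
    (f * g) i j p = ((splits p).map (fun s => f i s.1 s.2.1 * g s.1 j s.2.2)).sum := rfl

/-- Auxiliary to the ring axioms: the product of `f` with a column `g`. -/
def mulCol (f : CompletePathAlgebra k V) {i j : V} (g : ∀ l, Quiver.Path l j → k)
    (p : Quiver.Path i j) : k :=
  ((splits p).map (fun s => f i s.1 s.2.1 * g s.1 s.2.2)).sum

theorem mulCol_nil (f : CompletePathAlgebra k V) {j : V} (g : ∀ l, Quiver.Path l j → k) :
    mulCol f g (Quiver.Path.nil : Quiver.Path j j) = f j j Quiver.Path.nil * g j Quiver.Path.nil := by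
  simp [mulCol, splits]

theorem mulCol_cons (f : CompletePathAlgebra k V) {i j j' : V} (g : ∀ l, Quiver.Path l j' → k)
    (p : Quiver.Path i j) (a : j ⟶ j') :
    mulCol f g (p.cons a) =
      mulCol f (fun l q => g l (q.cons a)) p + f i j' (p.cons a) * g j' Quiver.Path.nil := by
  simp [mulCol, splits, Function.comp_def]

theorem mulCol_add (f : CompletePathAlgebra k V) {i j : V} (g h : ∀ l, Quiver.Path l j → k)
    (p : Quiver.Path i j) :
    mulCol f (fun l q => g l q + h l q) p = mulCol f g p + mulCol f h p := by
  simp [mulCol, mul_add, List.sum_map_add]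

theorem mulCol_mul_const (f : CompletePathAlgebra k V) {i j : V}
    (g : ∀ l, Quiver.Path l j → k) (c : k) (p : Quiver.Path i j) :
    mulCol f (fun l q => g l q * c) p = mulCol f g p * c := by
  simp only [mulCol, ← mul_assoc, List.sum_map_mul_right]

theorem mulCol_assoc (f g : CompletePathAlgebra k V) {i j : V} (p : Quiver.Path i j) :
    ∀ h : ∀ l, Quiver.Path l j → k, mulCol (f * g) h p = mulCol f (fun _ q => mulCol g h q) p := by
  induction p with
  | nil =>
    intro h
    simp only [mulCol_nil]
    rw [← mul_assoc]
    congr 1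
    exact mulCol_nil f (fun l q => g l i q)
  | @cons j j' p a ih =>
    intro h
    simp only [mulCol_cons, mulCol_nil]
    rw [ih, mulCol_add, mulCol_mul_const, ← mul_assoc, add_assoc, ← add_mul]
    congr 2
    exact mulCol_cons f (fun l q => g l j' q) p a

instance : Ring (CompletePathAlgebra k V) :=
  { (inferInstance : AddCommGroup (CompletePathAlgebra k V)) with
    mul := (· * ·)
    one := 1
    mul_assoc := fun f g h => by
      ext i j p
      exact mulCol_assoc f g p (fun l q => h l j q)
    one_mul := fun f => by
      ext i j p
      change mulCol 1 (fun l q => f l j q) p = f i j p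
      have key : ∀ {j : V} (p : Quiver.Path i j) (g : ∀ l, Quiver.Path l j → k),
          mulCol 1 g p = g i p := by
        intro j p
        induction p with
        | nil => intro g; simp [mulCol_nil, one_coeff]
        | cons p a ih => intro g; rw [mulCol_cons, ih]; simp [one_coeff]
      exact key p _
    mul_one := fun f => by
      ext i j p
      change mulCol f (fun l q => (1 : CompletePathAlgebra k V) l j q) p = f i j p
      cases p with
      | nil => simp [mulCol_nil, one_coeff]
      | cons p a => rw [mulCol_cons]; simp [mulCol, one_coeff]
    left_distrib := fun f g h => by
      ext i j p
      exact mulCol_add f (fun l q => g l j q) (fun l q => h l j q) p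
    right_distrib := fun f g h => by
      ext i j p
      simp [mul_coeff, add_mul, List.sum_map_add]
    zero_mul := fun f => by
      ext i j p
      simp [mul_coeff]
    mul_zero := fun f => by
      ext i j p
      simp [mul_coeff] }

instance : Algebra k (CompletePathAlgebra k V) :=
  Algebra.ofModule
    (fun c f g => by
      ext i j p
      simp only [mul_coeff, smul_coeff, mul_assoc, List.sum_map_mul_left])
    (fun c f g => by
      ext i j p
      simp only [mul_coeff, smul_coeff, mul_left_comm _ c, List.sum_map_mul_left])

open Classical in
/-- A path, as an element of the complete path algebra. -/
noncomputable def ofPath (k : Type*) [CommRing k] {V : Type*} [Quiver V] {i j : V}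
    (p : Quiver.Path i j) : CompletePathAlgebra k V :=
  fun i' j' q => if (⟨i', j', q⟩ : Σ i j : V, Quiver.Path i j) = ⟨i, j, p⟩ then 1 else 0

/-- The lazy path `e_v` at the vertex `v`. -/
noncomputable def idem (k : Type*) [CommRing k] {V : Type*} [Quiver V] (v : V) :
    CompletePathAlgebra k V :=
  ofPath k (Quiver.Path.nil : Quiver.Path v v)

/-- An arrow, as an element of the complete path algebra. -/
noncomputable def ofArrow (k : Type*) [CommRing k] {V : Type*} [Quiver V] {i j : V}
    (a : i ⟶ j) : CompletePathAlgebra k V :=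
  ofPath k a.toPath

/-- `𝔪 ^ d`, where `𝔪` is the (closed) ideal generated by the arrows: the elements all of whose
terms have path length at least `d`. These are the basic neighbourhoods of zero. -/
def maxPow (k : Type*) [CommRing k] (V : Type*) [Quiver V] (d : ℕ) :
    Submodule k (CompletePathAlgebra k V) where
  carrier := {f | ∀ i j (p : Quiver.Path i j), p.length < d → f i j p = 0}
  add_mem' := fun hf hg i j p hp => by simp [hf i j p hp, hg i j p hp]
  zero_mem' := fun _ _ _ _ => rfl
  smul_mem' := fun c f hf i j p hp => by simp [hf i j p hp]

/-- The vector space spanned by the commutators. -/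
def commutators (k : Type*) [CommRing k] (V : Type*) [Quiver V] :
    Submodule k (CompletePathAlgebra k V) :=
  Submodule.span k {c | ∃ p q : CompletePathAlgebra k V, c = p * q - q * p}

/-- `f` and `g` are cyclically equivalent: `f - g` lies in the closure, in the topology given by
the powers of `𝔪`, of the vector space spanned by the commutators. -/
def CycEquiv (f g : CompletePathAlgebra k V) : Prop :=
  ∀ d : ℕ, ∃ c ∈ commutators k V, f - g - c ∈ maxPow k V d

/-- A potential is a (possibly infinite) linear combination of cyclic paths. -/
def IsPotential (f : CompletePathAlgebra k V) : Prop :=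
  ∀ i j (p : Quiver.Path i j), f i j p ≠ 0 → i = j

/-- The component of `f` of path length two is zero. -/
def IsReduced (f : CompletePathAlgebra k V) : Prop :=
  ∀ i j (p : Quiver.Path i j), p.length = 2 → f i j p = 0

/-- `V(f)`: the span of all cycles that are cyclically equivalent to a cycle occurring in `f`. -/
noncomputable def cycleSpan (f : CompletePathAlgebra k V) :
    Submodule k (CompletePathAlgebra k V) :=
  Submodule.span k {x | ∃ (i j : V) (c : Quiver.Path i i) (d : Quiver.Path j j),
    x = ofPath k c ∧ f j j d ≠ 0 ∧ CycEquiv (ofPath k c) (ofPath k d)}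

/-- `f` is orthogonal to `g`. -/
def Orthogonal (f g : CompletePathAlgebra k V) : Prop :=
  cycleSpan f ⊓ cycleSpan g = ⊥

/-- `f` contains `g`: `f ∼ c g ⊕ h` for some non-zero scalar `c` and some potential `h`. -/
def Contains (f g : CompletePathAlgebra k V) : Prop :=
  ∃ (c : k) (h : CompletePathAlgebra k V),
    c ≠ 0 ∧ IsPotential h ∧ CycEquiv f (c • g + h) ∧ Orthogonal (c • g) h

/-- The algebra automorphism `ρ` is a right-equivalence from `f` to `g`: it fixes the vertex
subalgebra pointwise, and `ρ f` is cyclically equivalent to `g`. -/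
def IsRightEquivalence (ρ : CompletePathAlgebra k V ≃ₐ[k] CompletePathAlgebra k V)
    (f g : CompletePathAlgebra k V) : Prop :=
  (∀ v : V, ρ (idem k v) = idem k v) ∧ CycEquiv (ρ f) g

/-- The infinite sum `∑_{j ≥ 2} κ_j y ^ j`, for `y` without constant terms. As `y ^ j` has no terms
of path length less than `j`, only `j ≤ p.length` contributes to the coefficient of `p`. -/
def seriesFromTwo (κ : ℕ → k) (y : CompletePathAlgebra k V) : CompletePathAlgebra k V :=
  fun i j p => ∑ d ∈ Finset.Icc 2 p.length, κ d * (y ^ d) i j p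

end Algebra

end CompletePathAlgebra

/-! ### The quiver `Q_{n,I}` -/

/-- The vertices of `Q_{n,I}` are `0, …, n - 1`. -/
structure QVertex (n : ℕ) (I : Finset (Fin n)) where
  /-- The number of the vertex. -/
  num : Fin n

/-- The arrows of `Q_{n,I}`: a loop at each vertex not in `I`, and an arrow in each direction
between any two neighbouring vertices. -/
inductive QArrow (n : ℕ) (I : Finset (Fin n)) : QVertex n I → QVertex n I → Type
  | loop (v : QVertex n I) (hv : v.num ∉ I) : QArrow n I v v
  | right (v w : QVertex n I) (h : v.num.val + 1 = w.num.val) : QArrow n I v w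
  | left (v w : QVertex n I) (h : v.num.val + 1 = w.num.val) : QArrow n I w v

instance (n : ℕ) (I : Finset (Fin n)) : Quiver (QVertex n I) := ⟨QArrow n I⟩

/-- The index set of the elements `x_i`: one index for each loop, and one for each pair of
neighbouring vertices. -/
inductive QIndex (n : ℕ) (I : Finset (Fin n)) : Type
  | loop (v : QVertex n I) (hv : v.num ∉ I)
  | edge (v w : QVertex n I) (h : v.num.val + 1 = w.num.val)

namespace QIndex

variable {n : ℕ} {I : Finset (Fin n)}

/-- The position of an index, from left to right, in the quiver with all loops. -/
def pos : QIndex n I → ℕ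
  | loop v _ => 2 * v.num.val
  | edge v _ _ => 2 * v.num.val + 1

theorem pos_lt (i : QIndex n I) : i.pos < 2 * n - 1 := by
  cases i with
  | loop v hv => have := v.num.isLt; simp only [pos]; omega
  | edge v w h => have := w.num.isLt; simp only [pos]; omega

theorem pos_injective : Function.Injective (pos : QIndex n I → ℕ) := by
  intro i j h
  rcases i with ⟨⟨v⟩, hv⟩ | ⟨⟨v⟩, ⟨w⟩, hw⟩ <;> rcases j with ⟨⟨v'⟩, hv'⟩ | ⟨⟨v'⟩, ⟨w'⟩, hw'⟩ <;>
    simp only [pos] at h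
  · obtain rfl : v = v' := Fin.ext (by omega)
    rfl
  · omega
  · omega
  · change v.val + 1 = w.val at hw
    change v'.val + 1 = w'.val at hw'
    obtain rfl : v = v' := Fin.ext (by omega)
    obtain rfl : w = w' := Fin.ext (by omega)
    rfl

noncomputable instance : Fintype (QIndex n I) :=
  Fintype.ofInjective (fun i => (⟨i.pos, i.pos_lt⟩ : Fin (2 * n - 1)))
    (fun _ _ h => pos_injective (congrArg Fin.val h))

/-- `j` is the successor of `i` when the indices are labelled from left to right. -/
def IsNext (i j : QIndex n I) : Prop :=
  i.pos < j.pos ∧ ∀ l : QIndex n I, ¬ (i.pos < l.pos ∧ l.pos < j.pos)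

open CompletePathAlgebra

/-- The element `a_i`: a loop, or the arrow to the right. -/
noncomputable def a : QIndex n I → CompletePathAlgebra ℂ (QVertex n I)
  | loop v hv => ofArrow ℂ (show v ⟶ v from QArrow.loop v hv)
  | edge v w h => ofArrow ℂ (show v ⟶ w from QArrow.right v w h)

/-- The element `b_i`: the lazy path if `a_i` is a loop, and otherwise the arrow to the left. -/
noncomputable def b : QIndex n I → CompletePathAlgebra ℂ (QVertex n I)
  | loop v _ => idem ℂ v
  | edge v w h => ofArrow ℂ (show w ⟶ v from QArrow.left v w h)

/-- `x_i = a_i b_i`. -/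
noncomputable def x (i : QIndex n I) : CompletePathAlgebra ℂ (QVertex n I) := a i * b i

/-- `x_i' = b_i a_i`. -/
noncomputable def x' (i : QIndex n I) : CompletePathAlgebra ℂ (QVertex n I) := b i * a i

end QIndex

/-- The number of arrows `a_i` (loops and arrows to the right), with multiplicity, in a path. -/
def qDegree {n : ℕ} {I : Finset (Fin n)} {i : QVertex n I} :
    ∀ {j : QVertex n I}, Quiver.Path i j → ℕ
  | _, Quiver.Path.nil => 0
  | _, Quiver.Path.cons p (QArrow.loop _ _) => qDegree p + 1
  | _, Quiver.Path.cons p (QArrow.right _ _ _) => qDegree p + 1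
  | _, Quiver.Path.cons p (QArrow.left _ _ _) => qDegree p

open CompletePathAlgebra in
/-- Reduced Type A potentials on `Q_{n,I}`: reduced potentials, all of whose terms have degree at
least two, that contain `x_i' x_{i+1}` for each `i` that is not the last index. -/
def IsReducedTypeA {n : ℕ} {I : Finset (Fin n)} (f : CompletePathAlgebra ℂ (QVertex n I)) : Prop :=
  IsPotential f ∧ IsReduced f ∧
    (∀ (v w : QVertex n I) (p : Quiver.Path v w), f v w p ≠ 0 → 2 ≤ qDegree p) ∧
    ∀ i j : QIndex n I, i.IsNext j → Contains f (i.x' * j.x)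

open Classical CompletePathAlgebra in
/-- The potential `∑_{i < m} x_i' x_{i+1} + ∑_{i ≤ m} ∑_{j ≥ 2} κ_{ij} x_i ^ j`. -/
noncomputable def monomialPotential {n : ℕ} {I : Finset (Fin n)} (κ : QIndex n I → ℕ → ℂ) :
    CompletePathAlgebra ℂ (QVertex n I) :=
  (∑ i : QIndex n I, ∑ j : QIndex n I, if i.IsNext j then i.x' * j.x else 0) +
    ∑ i : QIndex n I, seriesFromTwo (κ i) i.x

open CompletePathAlgebra in
/-- Monomialized Type A potentials on `Q_{n,I}`. -/
def IsMonomializedTypeA {n : ℕ} {I : Finset (Fin n)}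
    (f : CompletePathAlgebra ℂ (QVertex n I)) : Prop :=
  IsPotential f ∧ ∃ κ : QIndex n I → ℕ → ℂ, CycEquiv f (monomialPotential κ)

/-! Write `j` for the successor of `i` and `l` for the successor of `j`. Up to rotation, every
nontrivial cycle is a power of some x_i or contains a factor b_j x_i' (`pure_or_hasPat`); this is
seen by starting the cycle at its leftmost vertex. Powers are allowed in the normal form. A term r p
b_j x_i' is cancelled by the substitution a_j ↦ a_j - r p, because the summand x_i' x_j = x_i' a_j
b_j then produces -r x_i' p b_j, a rotation of the same cycle.

The substitution also creates new terms, from x_j' x_l and from the powers of x_j. The arrows are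
weighted so that the weight of x_i, namely 2(4n + 1 + `pos`), increases strictly from left to right.
Hence the new terms are strictly heavier than the cancelled one (`removable_ofPath`). Eliminating
weight by weight, with substitutions that raise the weight more and more, gives a convergent
infinite composite (`exists_monomialization`), which is bijective by `RaisesBy.bijective`.

The weights are also nearly constant: a cycle of degree d has weight between (8n + 2)d and 12nd
(`degree_bounds`), so a cycle has weight at least 24n + 6 exactly when its degree is at least 3. The
elimination runs in that range. In degree two the cycles are, up to rotation, x_i' x_j for adjacent
indices, squares x_i ^ 2, and "skip" terms x_i' x_k for the two edges i, k at a vertex with a loop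
(`cycle_of_degree_two`). Squares of loops are absent because the potential is reduced. The
coefficients of the x_i' x_j are nonzero by containment and are scaled to 1 (`exists_scaling`), and
skip terms are removed by a_j ↦ a_j - r x_k at the loop j between i and k (`exists_remove_skip`).

Nonvanishing of coefficients modulo cyclic equivalence is detected by `cycleSum`, a trace that adds
up the coefficients of all cycles of a given weight and kills commutators. -/

/-! ### Weight filtrations of the complete path algebra -/

namespace CompletePathAlgebra

section Generic

variable {k : Type*} [CommRing k] {V : Type*} [Quiver V]

/-- The coefficient of a path, as a linear functional. -/
def coeffLM (k : Type*) [CommRing k] {V : Type*} [Quiver V] {i j : V} (p : Quiver.Path i j) :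
    CompletePathAlgebra k V →ₗ[k] k where
  toFun f := f i j p
  map_add' _ _ := rfl
  map_smul' _ _ := rfl

@[simp] theorem coeffLM_apply {i j : V} (p : Quiver.Path i j) (f : CompletePathAlgebra k V) :
    coeffLM k p f = f i j p := rfl

theorem sum_coeff {ι : Type*} (s : Finset ι) (g : ι → CompletePathAlgebra k V) {i j : V}
    (p : Quiver.Path i j) : (∑ t ∈ s, g t) i j p = ∑ t ∈ s, g t i j p :=
  map_sum (coeffLM k p) g s

@[simp] theorem sub_coeff (f g : CompletePathAlgebra k V) {i j : V} (p : Quiver.Path i j) :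
    (f - g) i j p = f i j p - g i j p := map_sub (coeffLM k p) f g

@[simp] theorem neg_coeff (f : CompletePathAlgebra k V) {i j : V} (p : Quiver.Path i j) :
    (-f) i j p = -f i j p := map_neg (coeffLM k p) f

open Classical in
theorem ofPath_coeff {i j : V} (p : Quiver.Path i j) {i' j' : V} (q : Quiver.Path i' j') :
    ofPath k p i' j' q =
      if (⟨i', j', q⟩ : Σ i j : V, Quiver.Path i j) = ⟨i, j, p⟩ then 1 else 0 := by
  unfold ofPath
  congr

@[simp] theorem ofPath_self {i j : V} (p : Quiver.Path i j) : ofPath k p i j p = 1 := by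
  simp [ofPath_coeff]

theorem ofPath_of_ne {i j : V} (p : Quiver.Path i j) {i' j' : V} (q : Quiver.Path i' j')
    (h : (⟨i', j', q⟩ : Σ i j : V, Quiver.Path i j) ≠ ⟨i, j, p⟩) : ofPath k p i' j' q = 0 := by
  simp [ofPath_coeff, h]

theorem splits_nodup {i j : V} (p : Quiver.Path i j) : (splits p).Nodup := by
  induction p with
  | nil => simp [splits]
  | cons p a ih =>
    rw [splits, List.nodup_append]
    refine ⟨ih.map ?_, by simp, ?_⟩
    · rintro ⟨l, q, r⟩ ⟨l', q', r'⟩ h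
      simp only [Sigma.mk.injEq] at h
      obtain ⟨rfl, h⟩ := h
      simp only [heq_eq_eq, Prod.mk.injEq, Quiver.Path.cons.injEq, true_and, and_true] at h
      obtain ⟨rfl, rfl⟩ := h
      rfl
    · intro s hs t ht hst
      simp only [List.mem_map, List.mem_singleton] at hs ht
      obtain ⟨u, -, rfl⟩ := hs
      subst ht
      have := congrArg (fun s : (Σ l : V, Quiver.Path i l × Quiver.Path l _) => s.2.2.length) hst
      simp at this

theorem ofPath_mul_ofPath {i j l : V} (p : Quiver.Path i j) (q : Quiver.Path j l) :
    ofPath k p * ofPath k q = ofPath k (p.comp q) := by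
  classical
  ext i' l' r
  rw [mul_coeff]
  by_cases h : (⟨i', l', r⟩ : Σ i j : V, Quiver.Path i j) = ⟨i, l, p.comp q⟩
  · cases h
    rw [ofPath_self, ← List.sum_toFinset _ (splits_nodup _),
      Finset.sum_eq_single (⟨j, p, q⟩ : Σ m : V, Quiver.Path i m × Quiver.Path m l)]
    · simp
    · rintro ⟨m, p', q'⟩ - hne
      by_cases hp : (⟨i, m, p'⟩ : Σ i j : V, Quiver.Path i j) = ⟨i, j, p⟩
      · cases hp
        have hq : (⟨j, l, q'⟩ : Σ i j : V, Quiver.Path i j) ≠ ⟨j, l, q⟩ := by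
          intro hq
          cases hq
          exact hne rfl
        simp only [ofPath_of_ne q q' hq, mul_zero]
      · simp only [ofPath_of_ne p p' hp, zero_mul]
    · intro hn
      exact absurd (List.mem_toFinset.2 ((mem_splits _ _).2 rfl)) hn
  · rw [ofPath_of_ne _ _ h]
    apply List.sum_eq_zero
    intro x hx
    obtain ⟨⟨m, p', q'⟩, hs, rfl⟩ := List.mem_map.1 hx
    rw [mem_splits] at hs
    simp only at hs
    by_cases hp : (⟨i', m, p'⟩ : Σ i j : V, Quiver.Path i j) = ⟨i, j, p⟩
    · cases hp
      have hq : (⟨j, l', q'⟩ : Σ i j : V, Quiver.Path i j) ≠ ⟨j, l, q⟩ := by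
        intro hq
        cases hq
        exact h (by rw [hs])
      simp only [ofPath_of_ne q q' hq, mul_zero]
    · simp only [ofPath_of_ne p p' hp, zero_mul]

theorem ofPath_mul_ofPath_of_ne {i j j' l : V} (p : Quiver.Path i j) (q : Quiver.Path j' l)
    (h : j ≠ j') : ofPath k p * ofPath k q = 0 := by
  ext i' l' r
  rw [mul_coeff, zero_coeff]
  apply List.sum_eq_zero
  intro x hx
  obtain ⟨⟨m, p', q'⟩, -, rfl⟩ := List.mem_map.1 hx
  by_cases hp : (⟨i', m, p'⟩ : Σ i j : V, Quiver.Path i j) = ⟨i, j, p⟩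
  · cases hp
    have hq : (⟨j, l', q'⟩ : Σ i j : V, Quiver.Path i j) ≠ ⟨j', l, q⟩ := by
      intro hq
      cases hq
      exact h rfl
    simp only [ofPath_of_ne q q' hq, mul_zero]
  · simp only [ofPath_of_ne p p' hp, zero_mul]

theorem ofPath_cons {i j l : V} (p : Quiver.Path i j) (a : j ⟶ l) :
    ofPath k (p.cons a) = ofPath k p * ofArrow k a := by
  rw [ofArrow, ofPath_mul_ofPath]
  rfl

theorem idem_mul_ofPath {i j : V} (p : Quiver.Path i j) : idem k i * ofPath k p = ofPath k p := by
  rw [idem, ofPath_mul_ofPath, Quiver.Path.nil_comp]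

theorem ofPath_mul_idem {i j : V} (p : Quiver.Path i j) : ofPath k p * idem k j = ofPath k p := by
  rw [idem, ofPath_mul_ofPath, Quiver.Path.comp_nil]

theorem idem_mul_idem (i : V) : idem k i * idem k i = idem k i := idem_mul_ofPath _

theorem idem_mul_idem_of_ne {i j : V} (h : i ≠ j) : idem k i * idem k j = 0 :=
  ofPath_mul_ofPath_of_ne _ _ h

theorem ofPath_injective [Nontrivial k] {i j : V} {p q : Quiver.Path i j}
    (h : ofPath k p = ofPath k q) : p = q := by
  by_contra hne
  have h1 : ofPath k p i j p = ofPath k q i j p := by rw [h]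
  rw [ofPath_self, ofPath_of_ne] at h1
  · exact one_ne_zero h1
  · intro h2
    cases h2
    exact hne rfl

theorem mul_sub_mul_mem_commutators (f g : CompletePathAlgebra k V) :
    f * g - g * f ∈ commutators k V :=
  Submodule.subset_span ⟨f, g, rfl⟩

/-- The additive extension to paths of a weight on the arrows. -/
def pathWt (ω : ∀ i j : V, (i ⟶ j) → ℕ) {i : V} : ∀ {j : V}, Quiver.Path i j → ℕ
  | _, Quiver.Path.nil => 0
  | _, Quiver.Path.cons p a => pathWt ω p + ω _ _ a

@[simp] theorem pathWt_nil (ω : ∀ i j : V, (i ⟶ j) → ℕ) (i : V) :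
    pathWt ω (Quiver.Path.nil : Quiver.Path i i) = 0 := rfl

@[simp] theorem pathWt_cons (ω : ∀ i j : V, (i ⟶ j) → ℕ) {i j l : V} (p : Quiver.Path i j)
    (a : j ⟶ l) : pathWt ω (p.cons a) = pathWt ω p + ω j l a := rfl

@[simp] theorem pathWt_toPath (ω : ∀ i j : V, (i ⟶ j) → ℕ) {i j : V} (a : i ⟶ j) :
    pathWt ω a.toPath = ω i j a := zero_add _

theorem pathWt_comp (ω : ∀ i j : V, (i ⟶ j) → ℕ) {i j l : V} (p : Quiver.Path i j)
    (q : Quiver.Path j l) : pathWt ω (p.comp q) = pathWt ω p + pathWt ω q := by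
  induction q with
  | nil => rfl
  | cons q a ih => simp only [Quiver.Path.comp_cons, pathWt_cons, ih, add_assoc]

/-- The elements all of whose terms have weight at least `d`, for an additive weight on the
arrows. -/
def wtPow (k : Type*) [CommRing k] {V : Type*} [Quiver V] (ω : ∀ i j : V, (i ⟶ j) → ℕ) (d : ℕ) :
    Submodule k (CompletePathAlgebra k V) where
  carrier := {f | ∀ i j (p : Quiver.Path i j), pathWt ω p < d → f i j p = 0}
  add_mem' := fun hf hg i j p hp => by simp [hf i j p hp, hg i j p hp]
  zero_mem' := fun _ _ _ _ => rfl
  smul_mem' := fun c f hf i j p hp => by simp [hf i j p hp]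

variable {ω : ∀ i j : V, (i ⟶ j) → ℕ}

theorem wtPow_mono {d e : ℕ} (h : d ≤ e) : wtPow k (V := V) ω e ≤ wtPow k ω d :=
  fun _ hf i j p hp => hf i j p (lt_of_lt_of_le hp h)

theorem mem_wtPow_zero (f : CompletePathAlgebra k V) : f ∈ wtPow k ω 0 :=
  fun _ _ _ hp => absurd hp (Nat.not_lt_zero _)

theorem ofPath_mem_wtPow {i j : V} (p : Quiver.Path i j) :
    ofPath k p ∈ wtPow k ω (pathWt ω p) := by
  intro i' j' q hq
  apply ofPath_of_ne
  intro h
  cases h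
  exact lt_irrefl _ hq

theorem mul_mem_wtPow {d e : ℕ} {f g : CompletePathAlgebra k V} (hf : f ∈ wtPow k ω d)
    (hg : g ∈ wtPow k ω e) : f * g ∈ wtPow k ω (d + e) := by
  intro i j p hp
  rw [mul_coeff]
  apply List.sum_eq_zero
  intro x hx
  obtain ⟨⟨m, q, r⟩, hs, rfl⟩ := List.mem_map.1 hx
  rw [mem_splits] at hs
  simp only at hs
  subst hs
  rw [pathWt_comp] at hp
  by_cases h : pathWt ω q < d
  · simp only [hf _ _ _ h, zero_mul]
  · simp only [hg _ _ r (by omega), mul_zero]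

theorem mul_mem_wtPow_left {d : ℕ} {f : CompletePathAlgebra k V} (hf : f ∈ wtPow k ω d)
    (g : CompletePathAlgebra k V) : f * g ∈ wtPow k ω d :=
  mul_mem_wtPow hf (mem_wtPow_zero g)

theorem mul_mem_wtPow_right {d : ℕ} {g : CompletePathAlgebra k V} (f : CompletePathAlgebra k V)
    (hg : g ∈ wtPow k ω d) : f * g ∈ wtPow k ω d := by
  simpa using mul_mem_wtPow (mem_wtPow_zero (ω := ω) f) hg

theorem pow_mem_wtPow {d : ℕ} {f : CompletePathAlgebra k V} (hf : f ∈ wtPow k ω d) (m : ℕ) :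
    f ^ m ∈ wtPow k ω (m * d) := by
  induction m with
  | zero => simpa using mem_wtPow_zero _
  | succ m ih =>
    rw [pow_succ, Nat.succ_mul]
    exact mul_mem_wtPow ih hf

theorem eq_zero_of_forall_mem_wtPow {f : CompletePathAlgebra k V}
    (h : ∀ d, f ∈ wtPow k ω d) : f = 0 := by
  ext i j p
  exact h (pathWt ω p + 1) i j p (Nat.lt_succ_self _)

theorem length_le_pathWt (hω : ∀ (i j : V) (a : i ⟶ j), 1 ≤ ω i j a) {i j : V}
    (p : Quiver.Path i j) : p.length ≤ pathWt ω p := by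
  induction p with
  | nil => simp
  | cons p a ih =>
    simp only [Quiver.Path.length_cons, pathWt_cons]
    exact add_le_add ih (hω _ _ a)

/-- A sequence of elements that is Cauchy for the weight filtration has a limit. -/
theorem exists_limit (x : ℕ → CompletePathAlgebra k V)
    (hx : ∀ m, x (m + 1) - x m ∈ wtPow k ω m) :
    ∃ y : CompletePathAlgebra k V, ∀ m, y - x m ∈ wtPow k ω m := by
  have key : ∀ m l, x (m + l) - x m ∈ wtPow k ω m := by
    intro m l
    induction l with
    | zero => simp
    | succ l ih =>
      have := add_mem (wtPow_mono (Nat.le_add_right m l) (hx (m + l))) ih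
      rwa [sub_add_sub_cancel] at this
  -- From index `pathWt ω p + 1` on, the coefficient of `p` in the sequence no longer changes, so
  -- the limit reads it off there.
  refine ⟨fun i j p => x (pathWt ω p + 1) i j p, fun m i j p hp => ?_⟩
  obtain ⟨l, rfl⟩ := Nat.exists_eq_add_of_lt hp
  have := key (pathWt ω p + 1) l i j p (Nat.lt_succ_self _)
  rw [sub_coeff, sub_eq_zero] at this
  refine (sub_coeff _ _ _).trans (sub_eq_zero.2 ?_)
  rw [add_right_comm, this]

/-- The image of a path under the substitution `φ`. -/
noncomputable def substPath (φ : ∀ i j : V, (i ⟶ j) → CompletePathAlgebra k V) {i : V} :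
    ∀ {j : V}, Quiver.Path i j → CompletePathAlgebra k V
  | _, Quiver.Path.nil => idem k i
  | _, Quiver.Path.cons p a => substPath φ p * φ _ _ a

/-- The arrow `a : i → j` is sent to an element of `e_i A e_j`, whose terms have at least the
weight of `a`. -/
structure IsSubst (ω : ∀ i j : V, (i ⟶ j) → ℕ)
    (φ : ∀ i j : V, (i ⟶ j) → CompletePathAlgebra k V) : Prop where
  left : ∀ (i j : V) (a : i ⟶ j), idem k i * φ i j a = φ i j a
  right : ∀ (i j : V) (a : i ⟶ j), φ i j a * idem k j = φ i j a
  weight : ∀ (i j : V) (a : i ⟶ j), φ i j a ∈ wtPow k ω (ω i j a)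

variable {φ : ∀ i j : V, (i ⟶ j) → CompletePathAlgebra k V}

theorem idem_mul_substPath {i j : V} (p : Quiver.Path i j) :
    idem k i * substPath φ p = substPath φ p := by
  induction p with
  | nil => exact idem_mul_idem _
  | cons p a ih => rw [substPath, ← mul_assoc, ih]

theorem IsSubst.substPath_mul_idem (h : IsSubst ω φ) {i j : V} (p : Quiver.Path i j) :
    substPath φ p * idem k j = substPath φ p := by
  cases p with
  | nil => exact idem_mul_idem _
  | cons p a => rw [substPath, mul_assoc, h.right]

theorem IsSubst.substPath_comp (h : IsSubst ω φ) {i j l : V} (p : Quiver.Path i j)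
    (q : Quiver.Path j l) : substPath φ (p.comp q) = substPath φ p * substPath φ q := by
  induction q with
  | nil => exact (h.substPath_mul_idem p).symm
  | cons q a ih => rw [Quiver.Path.comp_cons, substPath, ih, substPath, mul_assoc]

theorem IsSubst.substPath_mem (h : IsSubst ω φ) {i j : V} (p : Quiver.Path i j) :
    substPath φ p ∈ wtPow k ω (pathWt ω p) := by
  induction p with
  | nil => exact mem_wtPow_zero _
  | cons p a ih => exact mul_mem_wtPow ih (h.weight _ _ a)

theorem IsSubst.substPath_mul_of_ne (h : IsSubst ω φ) {i j j' l : V} (p : Quiver.Path i j)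
    (q : Quiver.Path j' l) (hne : j ≠ j') : substPath φ p * substPath φ q = 0 := by
  rw [← h.substPath_mul_idem p, ← idem_mul_substPath q, mul_assoc, ← mul_assoc (idem k j),
    idem_mul_idem_of_ne hne, zero_mul, mul_zero]

theorem sum_idem [Fintype V] : ∑ v : V, idem k v = 1 := by
  classical
  ext i j p
  rw [sum_coeff, one_coeff]
  cases p with
  | nil =>
    rw [Finset.sum_eq_single i]
    · simp [idem]
    · intro v _ hv
      refine ofPath_of_ne _ _ fun h => hv ?_
      cases h
      rfl
    · simp
  | cons p a =>
    rw [if_neg (by simp)]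
    refine Finset.sum_eq_zero fun v _ => ofPath_of_ne _ _ fun h => ?_
    cases h

/-- Endomorphisms that fix the lazy paths, and that change elements only by terms whose weight is
larger by at least `δ`. -/
structure RaisesBy (ω : ∀ i j : V, (i ⟶ j) → ℕ) (δ : ℕ)
    (Φ : CompletePathAlgebra k V →ₐ[k] CompletePathAlgebra k V) : Prop where
  idem : ∀ v : V, Φ (idem k v) = idem k v
  raise : ∀ d, ∀ f ∈ wtPow k ω d, Φ f - f ∈ wtPow k ω (d + δ)

theorem RaisesBy.mem {δ : ℕ} {Φ : CompletePathAlgebra k V →ₐ[k] CompletePathAlgebra k V}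
    (h : RaisesBy ω δ Φ) {d : ℕ} {f : CompletePathAlgebra k V} (hf : f ∈ wtPow k ω d) :
    Φ f ∈ wtPow k ω d := by
  rw [← sub_add_cancel (Φ f) f]
  exact add_mem (wtPow_mono (Nat.le_add_right _ _) (h.raise d f hf)) hf

theorem RaisesBy.mono {δ δ' : ℕ} {Φ : CompletePathAlgebra k V →ₐ[k] CompletePathAlgebra k V}
    (h : RaisesBy ω δ Φ) (hδ : δ' ≤ δ) : RaisesBy ω δ' Φ :=
  ⟨h.idem, fun d f hf => wtPow_mono (by omega) (h.raise d f hf)⟩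

theorem RaisesBy.id (δ : ℕ) : RaisesBy ω δ (AlgHom.id k (CompletePathAlgebra k V)) :=
  ⟨fun _ => rfl, fun d f _ => by simp⟩

theorem RaisesBy.comp {δ : ℕ} {Φ Ψ : CompletePathAlgebra k V →ₐ[k] CompletePathAlgebra k V}
    (hΦ : RaisesBy ω δ Φ) (hΨ : RaisesBy ω δ Ψ) : RaisesBy ω δ (Φ.comp Ψ) := by
  refine ⟨fun v => ?_, fun d f hf => ?_⟩
  · rw [AlgHom.comp_apply, hΨ.idem, hΦ.idem]
  · rw [AlgHom.comp_apply, ← sub_add_sub_cancel _ (Ψ f)]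
    exact add_mem (hΦ.raise d _ (hΨ.mem hf)) (hΨ.raise d f hf)

/-- An element of the kernel equals minus its own correction, so it lies in every step of the
separated filtration. For surjectivity, each pass of z ↦ z + (y - Φ z) raises the weight of the
error y - Φ z by at least one, and the iterates converge. -/
theorem RaisesBy.bijective {Φ : CompletePathAlgebra k V →ₐ[k] CompletePathAlgebra k V}
    (h : RaisesBy ω 1 Φ) : Function.Bijective Φ := by
  refine ⟨(injective_iff_map_eq_zero Φ).2 fun f hf => ?_, fun y => ?_⟩
  · refine eq_zero_of_forall_mem_wtPow (ω := ω) fun d => ?_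
    induction d with
    | zero => exact mem_wtPow_zero f
    | succ d ih =>
      have := h.raise d f ih
      rw [hf, zero_sub] at this
      exact (Submodule.neg_mem_iff _).1 this
  · let x : ℕ → CompletePathAlgebra k V := fun m => (fun z => z + (y - Φ z))^[m] 0
    have hx : ∀ m, x (m + 1) = x m + (y - Φ (x m)) :=
      fun m => Function.iterate_succ_apply' _ _ _
    have hy : ∀ m, y - Φ (x m) ∈ wtPow k ω m := by
      intro m
      induction m with
      | zero => exact mem_wtPow_zero _
      | succ m ih =>
        have := h.raise m _ ih
        rw [hx, map_add, ← sub_sub]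
        rw [← neg_sub] at this
        exact (Submodule.neg_mem_iff _).1 (by simpa using this)
    obtain ⟨z, hz⟩ := exists_limit (ω := ω) x fun m => by
      rw [hx, add_sub_cancel_left]
      exact hy m
    refine ⟨z, ?_⟩
    rw [← sub_eq_zero]
    refine eq_zero_of_forall_mem_wtPow (ω := ω) fun m => ?_
    have h1 := sub_mem (h.mem (hz m)) (hy m)
    rwa [map_sub, sub_sub, add_sub_cancel] at h1

/-- The elements that, up to cyclic equivalence, have weight at least `d`. -/
def cycPow (k : Type*) [CommRing k] {V : Type*} [Quiver V] (ω : ∀ i j : V, (i ⟶ j) → ℕ) (d : ℕ) :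
    Submodule k (CompletePathAlgebra k V) :=
  commutators k V ⊔ wtPow k ω d

theorem commutators_le_cycPow (d : ℕ) : commutators k V ≤ cycPow k ω d := le_sup_left

theorem wtPow_le_cycPow (d : ℕ) : wtPow k ω d ≤ cycPow k (V := V) ω d := le_sup_right

theorem cycPow_mono {d e : ℕ} (h : d ≤ e) : cycPow k (V := V) ω e ≤ cycPow k ω d :=
  sup_le_sup_left (wtPow_mono h) _

theorem map_mem_commutators (Φ : CompletePathAlgebra k V →ₐ[k] CompletePathAlgebra k V)
    {f : CompletePathAlgebra k V} (hf : f ∈ commutators k V) : Φ f ∈ commutators k V := by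
  have : commutators k V ≤ (commutators k V).comap Φ.toLinearMap := by
    refine Submodule.span_le.2 ?_
    rintro _ ⟨p, q, rfl⟩
    change Φ (p * q - q * p) ∈ commutators k V
    rw [map_sub, map_mul, map_mul]
    exact mul_sub_mul_mem_commutators _ _
  exact this hf

theorem map_mem_cycPow (Φ : CompletePathAlgebra k V →ₐ[k] CompletePathAlgebra k V) {d : ℕ}
    (h : ∀ f : CompletePathAlgebra k V, f ∈ wtPow k ω d → Φ f ∈ wtPow k ω d)
    {f : CompletePathAlgebra k V}
    (hf : f ∈ cycPow k ω d) : Φ f ∈ cycPow k ω d := by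
  obtain ⟨c, hc, g, hg, rfl⟩ := Submodule.mem_sup.1 hf
  rw [map_add]
  exact Submodule.add_mem_sup (map_mem_commutators Φ hc) (h g hg)

/-- With arrow weights at most `C`, a path of length below `d` has weight below `C * d + 1`, so the
weight topology refines the 𝔪-adic one. `CycEquiv.mem_cycPow` is the converse comparison, from
weights at least 1. -/
theorem CycEquiv.of_mem_cycPow {C : ℕ} (hC : ∀ (i j : V) (a : i ⟶ j), ω i j a ≤ C)
    {f g : CompletePathAlgebra k V} (h : ∀ d, f - g ∈ cycPow k ω d) : CycEquiv f g := by
  have hlen : ∀ {i j : V} (p : Quiver.Path i j), pathWt ω p ≤ C * p.length := by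
    intro i j p
    induction p with
    | nil => simp
    | cons p a ih =>
      have := hC _ _ a
      rw [pathWt_cons, Quiver.Path.length_cons, mul_add, mul_one]
      omega
  intro d
  obtain ⟨c, hc, r, hr, e⟩ := Submodule.mem_sup.1 (h (C * d + 1))
  refine ⟨c, hc, ?_⟩
  rw [← e, add_sub_cancel_left]
  intro i j p hp
  refine hr i j p (lt_of_le_of_lt (hlen p) (Nat.lt_succ_of_le ?_))
  exact Nat.mul_le_mul_left _ hp.le

theorem CycEquiv.mem_cycPow (hω : ∀ (i j : V) (a : i ⟶ j), 1 ≤ ω i j a)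
    {f g : CompletePathAlgebra k V} (h : CycEquiv f g) (d : ℕ) : f - g ∈ cycPow k ω d := by
  obtain ⟨c, hc, hr⟩ := h d
  rw [← add_sub_cancel c (f - g)]
  refine Submodule.add_mem_sup hc fun i j p hp => hr i j p ?_
  exact lt_of_le_of_lt (length_le_pathWt hω p) hp

theorem ofPath_mem_commutators_of_ne {i j : V} (p : Quiver.Path i j) (h : i ≠ j) :
    ofPath k p ∈ commutators k V := by
  have : ofPath k p = idem k i * ofPath k p - ofPath k p * idem k i := by
    rw [idem_mul_ofPath, idem, ofPath_mul_ofPath_of_ne _ _ h.symm, sub_zero]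
  rw [this]
  exact mul_sub_mul_mem_commutators _ _

theorem map_one_of_map_idem [Finite V] {T : CompletePathAlgebra k V →ₗ[k] CompletePathAlgebra k V}
    (h : ∀ v : V, T (idem k v) = idem k v) : T 1 = 1 := by
  have := Fintype.ofFinite V
  rw [← sum_idem, map_sum]
  exact Finset.sum_congr rfl fun v _ => h v

/-- The limit of a sequence of endomorphisms that is Cauchy for the weight filtration. -/
theorem RaisesBy.exists_limit [Finite V] {δ : ℕ}
    (Φ : ℕ → CompletePathAlgebra k V →ₐ[k] CompletePathAlgebra k V)
    (h : ∀ m, RaisesBy ω δ (Φ m)) (hΦ : ∀ m f, Φ (m + 1) f - Φ m f ∈ wtPow k ω m) :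
    ∃ Ψ : CompletePathAlgebra k V →ₐ[k] CompletePathAlgebra k V, RaisesBy ω δ Ψ ∧
      ∀ m f, Ψ f - Φ m f ∈ wtPow k ω m := by
  choose T hT using fun f => CompletePathAlgebra.exists_limit (ω := ω) (fun m => Φ m f)
    (fun m => hΦ m f)
  -- Limits are unique because the filtration is separated. Linearity, multiplicativity and the
  -- values on lazy paths all follow by exhibiting the expected value as a limit.
  have uniq : ∀ f y, (∀ m, y - Φ m f ∈ wtPow k ω m) → T f = y := by
    intro f y hy
    rw [← sub_eq_zero]
    refine eq_zero_of_forall_mem_wtPow (ω := ω) fun m => ?_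
    simpa using sub_mem (hT f m) (hy m)
  have idem_eq : ∀ v : V, T (CompletePathAlgebra.idem k v) = CompletePathAlgebra.idem k v :=
    fun v => uniq _ _ fun m => by simp [(h m).idem]
  let L : CompletePathAlgebra k V →ₗ[k] CompletePathAlgebra k V :=
    { toFun := T
      map_add' := fun f g => uniq _ _ fun m => by
        rw [map_add, add_sub_add_comm]
        exact add_mem (hT f m) (hT g m)
      map_smul' := fun c f => uniq _ _ fun m => by
        rw [map_smul, RingHom.id_apply, ← smul_sub]
        exact Submodule.smul_mem _ _ (hT f m) }
  refine ⟨AlgHom.ofLinearMap L (map_one_of_map_idem idem_eq) fun f g => uniq _ _ fun m => ?_,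
    ⟨idem_eq, fun d f hf => ?_⟩, fun m f => hT f m⟩
  · have e : T f * T g - Φ m (f * g) = (T f - Φ m f) * T g + Φ m f * (T g - Φ m g) := by
      rw [map_mul]
      noncomm_ring
    exact e ▸ add_mem (mul_mem_wtPow_left (hT f m) _) (mul_mem_wtPow_right _ (hT g m))
  · have := add_mem (hT f (d + δ)) ((h (d + δ)).raise d f hf)
    rwa [sub_add_sub_cancel] at this

end Generic

/-! ### Substitution endomorphisms and the trace functional, for finite quivers. -/

section FiniteType

variable {k : Type*} [CommRing k] {V : Type*} [Quiver V] [Finite V] [∀ i j : V, Finite (i ⟶ j)]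
variable {φ : ∀ i j : V, (i ⟶ j) → CompletePathAlgebra k V}
variable {ω : ∀ i j : V, (i ⟶ j) → ℕ}

/-- Since every arrow has positive weight, removing the last arrow lowers the bound `N`. Finiteness
turns truncations, substitutions and the trace into finite sums. -/
theorem finite_pathWt_lt (hω : ∀ (i j : V) (a : i ⟶ j), 1 ≤ ω i j a) (N : ℕ) :
    {P : Σ i j : V, Quiver.Path i j | pathWt ω P.2.2 < N}.Finite := by
  have key : ∀ i : V, {P : Σ j : V, Quiver.Path i j | pathWt ω P.2 < N}.Finite := by
    intro i
    induction N with
    | zero => simp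
    | succ N ih =>
      refine ((Set.finite_singleton (⟨i, Quiver.Path.nil⟩ : Σ j : V, Quiver.Path i j)).union
        (ih.biUnion (t := fun P => ⋃ l : V, ⋃ a : P.1 ⟶ l, {⟨l, P.2.cons a⟩})
          fun P _ => Set.finite_iUnion fun l => Set.finite_iUnion fun a =>
            Set.finite_singleton _)).subset ?_
      rintro ⟨j, p⟩ hp
      cases p with
      | nil => left; rfl
      | @cons b _ p a =>
        right
        simp only [Set.mem_iUnion, Set.mem_singleton_iff, Set.mem_ofPred_eq,
          pathWt_cons] at hp ⊢
        exact ⟨⟨b, p⟩, by have := hω _ _ a; simp only; omega, _, a, rfl⟩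
  refine (Set.finite_iUnion fun i : V =>
    (key i).image (fun P => (⟨i, P⟩ : Σ i j : V, Quiver.Path i j))).subset ?_
  rintro ⟨i, P⟩ hP
  exact Set.mem_iUnion.2 ⟨i, P, hP, rfl⟩

/-- The finite set of all paths of weight less than `N`. -/
noncomputable def pathsBelow (hω : ∀ (i j : V) (a : i ⟶ j), 1 ≤ ω i j a) (N : ℕ) :
    Finset (Σ i j : V, Quiver.Path i j) :=
  (finite_pathWt_lt hω N).toFinset

theorem mem_pathsBelow (hω : ∀ (i j : V) (a : i ⟶ j), 1 ≤ ω i j a)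
    {N : ℕ} {P : Σ i j : V, Quiver.Path i j} :
    P ∈ pathsBelow hω N ↔ pathWt ω P.2.2 < N := by
  simp [pathsBelow]

/-- The sum of the terms of `f` of weight less than `N`. -/
noncomputable def trunc (hω : ∀ (i j : V) (a : i ⟶ j), 1 ≤ ω i j a)
    (N : ℕ) (f : CompletePathAlgebra k V) : CompletePathAlgebra k V :=
  ∑ P ∈ pathsBelow hω N, f P.1 P.2.1 P.2.2 • ofPath k P.2.2

theorem sub_trunc_mem (hω : ∀ (i j : V) (a : i ⟶ j), 1 ≤ ω i j a)
    (N : ℕ) (f : CompletePathAlgebra k V) :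
    f - trunc hω N f ∈ wtPow k ω N := by
  classical
  intro i j p hp
  rw [sub_coeff, trunc, sum_coeff, Finset.sum_eq_single ⟨i, j, p⟩]
  · simp
  · rintro ⟨i', j', q⟩ - hne
    rw [smul_coeff, ofPath_of_ne _ _ hne.symm, mul_zero]
  · intro h
    exact absurd ((mem_pathsBelow hω).2 hp) h

/-- Density of finite combinations of paths: modulo weight `N` an element equals its truncation, so
a filtered linear map is controlled by its values on paths. -/
theorem map_mem_of_ofPath (hω : ∀ (i j : V) (a : i ⟶ j), 1 ≤ ω i j a) {N : ℕ}
    (T : CompletePathAlgebra k V →ₗ[k] CompletePathAlgebra k V)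
    (hT : ∀ f ∈ wtPow k ω N, T f ∈ wtPow k ω N)
    (hp : ∀ (i j : V) (p : Quiver.Path i j), T (ofPath k p) ∈ wtPow k ω N)
    (f : CompletePathAlgebra k V) : T f ∈ wtPow k ω N := by
  rw [← sub_add_cancel f (trunc hω N f), map_add]
  refine add_mem (hT _ (sub_trunc_mem hω N f)) ?_
  rw [trunc, map_sum]
  refine Submodule.sum_mem _ fun P _ => ?_
  rw [map_smul]
  exact Submodule.smul_mem _ _ (hp _ _ _)

/-- The linear extension of a substitution to infinite linear combinations of paths. -/
noncomputable def substLM (hω : ∀ (i j : V) (a : i ⟶ j), 1 ≤ ω i j a)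
    (φ : ∀ i j : V, (i ⟶ j) → CompletePathAlgebra k V) :
    CompletePathAlgebra k V →ₗ[k] CompletePathAlgebra k V where
  toFun f i j q := ∑ P ∈ pathsBelow hω (pathWt ω q + 1),
    f P.1 P.2.1 P.2.2 * substPath φ P.2.2 i j q
  map_add' f g := by
    ext i j q
    simp only [add_coeff, add_mul, Finset.sum_add_distrib]
    rfl
  map_smul' c f := by
    ext i j q
    simp only [smul_coeff, mul_assoc, ← Finset.mul_sum]
    rfl

theorem IsSubst.substLM_coeff (hω : ∀ (i j : V) (a : i ⟶ j), 1 ≤ ω i j a)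
    (h : IsSubst ω φ) (f : CompletePathAlgebra k V) {i j : V}
    (q : Quiver.Path i j) {N : ℕ} (hN : pathWt ω q < N) : substLM hω φ f i j q =
      ∑ P ∈ pathsBelow hω N, f P.1 P.2.1 P.2.2 * substPath φ P.2.2 i j q := by
  refine Finset.sum_subset (fun P hP => ?_) fun P _ hP => ?_
  · rw [mem_pathsBelow] at hP ⊢
    omega
  · rw [mem_pathsBelow, not_lt] at hP
    rw [h.substPath_mem P.2.2 i j q hP, mul_zero]

theorem IsSubst.substLM_ofPath (hω : ∀ (i j : V) (a : i ⟶ j), 1 ≤ ω i j a)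
    (h : IsSubst ω φ) {i j : V} (p : Quiver.Path i j) :
    substLM hω φ (ofPath k p) = substPath φ p := by
  ext i' j' q
  rw [h.substLM_coeff hω _ q (N := max (pathWt ω q) (pathWt ω p) + 1) (by omega),
    Finset.sum_eq_single ⟨i, j, p⟩]
  · simp
  · rintro ⟨i', j', q⟩ - hne
    rw [ofPath_of_ne _ _ hne, zero_mul]
  · intro hn
    exact absurd ((mem_pathsBelow hω).2 (by simp only; omega)) hn

theorem IsSubst.substLM_mem (hω : ∀ (i j : V) (a : i ⟶ j), 1 ≤ ω i j a)
    (h : IsSubst ω φ) {d : ℕ} {f : CompletePathAlgebra k V}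
    (hf : f ∈ wtPow k ω d) : substLM hω φ f ∈ wtPow k ω d := by
  intro i j q hq
  refine Finset.sum_eq_zero fun P _ => ?_
  by_cases hP : pathWt ω P.2.2 < d
  · rw [hf _ _ _ hP, zero_mul]
  · rw [h.substPath_mem P.2.2 i j q (by omega), mul_zero]

/-- A linear endomorphism that respects the weight filtration and that is multiplicative on paths
is multiplicative. -/
theorem map_mul_of_ofPath (hω : ∀ (i j : V) (a : i ⟶ j), 1 ≤ ω i j a)
    (T : CompletePathAlgebra k V →ₗ[k] CompletePathAlgebra k V)
    (hT : ∀ d, ∀ f ∈ wtPow k ω d, T f ∈ wtPow k ω d)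
    (h : ∀ (i j j' l : V) (p : Quiver.Path i j) (q : Quiver.Path j' l),
      T (ofPath k p * ofPath k q) = T (ofPath k p) * T (ofPath k q))
    (f g : CompletePathAlgebra k V) : T (f * g) = T f * T g := by
  rw [← sub_eq_zero]
  refine eq_zero_of_forall_mem_wtPow (ω := ω) fun N => ?_
  -- Density is used once per factor: here the left factor is a path and the right one arbitrary,
  -- afterwards the left factor is freed as well.
  have step : ∀ (i j : V) (p : Quiver.Path i j),
      T (ofPath k p * g) - T (ofPath k p) * T g ∈ wtPow k ω N := by
    intro i j p
    refine map_mem_of_ofPath hω (T ∘ₗ LinearMap.mulLeft k (ofPath k p) -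
      LinearMap.mulLeft k (T (ofPath k p)) ∘ₗ T) (fun f hf => ?_) (fun i' j' q => ?_) g
    · exact sub_mem (hT _ _ (mul_mem_wtPow_right _ hf)) (mul_mem_wtPow_right _ (hT _ _ hf))
    · simp [h]
  refine map_mem_of_ofPath hω (T ∘ₗ LinearMap.mulRight k g -
      LinearMap.mulRight k (T g) ∘ₗ T) (fun f hf => ?_) step f
  exact sub_mem (hT _ _ (mul_mem_wtPow_left hf _)) (mul_mem_wtPow_left (hT _ _ hf) _)

/-- The algebra endomorphism given by a substitution. -/
noncomputable def IsSubst.hom (h : IsSubst ω φ)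
    (hω : ∀ (i j : V) (a : i ⟶ j), 1 ≤ ω i j a) :
    CompletePathAlgebra k V →ₐ[k] CompletePathAlgebra k V :=
  AlgHom.ofLinearMap (substLM hω φ)
    (map_one_of_map_idem (T := substLM hω φ) fun v =>
      h.substLM_ofPath hω (Quiver.Path.nil : Quiver.Path v v))
    (map_mul_of_ofPath hω _ (fun _ _ hf => h.substLM_mem hω hf) fun i j j' l p q => by
      rw [h.substLM_ofPath, h.substLM_ofPath]
      by_cases hj : j = j'
      · subst hj
        rw [ofPath_mul_ofPath, h.substLM_ofPath, h.substPath_comp]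
      · rw [ofPath_mul_ofPath_of_ne _ _ hj, h.substPath_mul_of_ne _ _ hj, map_zero])

theorem IsSubst.hom_ofPath (hω : ∀ (i j : V) (a : i ⟶ j), 1 ≤ ω i j a)
    (h : IsSubst ω φ) {i j : V} (p : Quiver.Path i j) :
    h.hom hω (ofPath k p) = substPath φ p :=
  h.substLM_ofPath hω p

theorem IsSubst.hom_idem (hω : ∀ (i j : V) (a : i ⟶ j), 1 ≤ ω i j a)
    (h : IsSubst ω φ) (v : V) : h.hom hω (idem k v) = idem k v :=
  h.hom_ofPath hω (Quiver.Path.nil : Quiver.Path v v)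

theorem IsSubst.hom_ofArrow (hω : ∀ (i j : V) (a : i ⟶ j), 1 ≤ ω i j a)
    (h : IsSubst ω φ) {i j : V} (a : i ⟶ j) :
    h.hom hω (ofArrow k a) = φ i j a :=
  (h.hom_ofPath hω a.toPath).trans (h.left i j a)

/-- On a path the difference telescopes: arrows are replaced one at a time, and each replacement
gains weight `δ`. Truncation at `d + δ` reduces the general case to paths. -/
theorem IsSubst.raisesBy (hω : ∀ (i j : V) (a : i ⟶ j), 1 ≤ ω i j a) (h : IsSubst ω φ) {δ : ℕ}
    (hδ : ∀ (i j : V) (a : i ⟶ j), φ i j a - ofArrow k a ∈ wtPow k ω (ω i j a + δ)) :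
    RaisesBy ω δ (h.hom hω) := by
  refine ⟨h.hom_idem hω, fun d f hf => ?_⟩
  have hp : ∀ (i j : V) (p : Quiver.Path i j),
      substPath φ p - ofPath k p ∈ wtPow k ω (pathWt ω p + δ) := by
    intro i j p
    induction p with
    | nil =>
      have : substPath φ (Quiver.Path.nil : Quiver.Path i i) - ofPath k Quiver.Path.nil = 0 :=
        sub_self _
      rw [this]
      exact zero_mem _
    | cons p a ih =>
      have e : substPath φ (p.cons a) - ofPath k (p.cons a) =
          (substPath φ p - ofPath k p) * φ _ _ a + ofPath k p * (φ _ _ a - ofArrow k a) := by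
        rw [substPath, ofPath_cons]
        noncomm_ring
      rw [e, pathWt_cons]
      refine add_mem ?_ ?_
      · have := mul_mem_wtPow ih (h.weight _ _ a)
        rwa [add_right_comm] at this
      · have := mul_mem_wtPow (ofPath_mem_wtPow (k := k) (ω := ω) p) (hδ _ _ a)
        rwa [← add_assoc] at this
  have key : ∀ g ∈ wtPow k ω (d + δ), h.hom hω g - g ∈ wtPow k ω (d + δ) :=
    fun g hg => sub_mem (h.substLM_mem hω hg) hg
  rw [← sub_add_cancel f (trunc hω (d + δ) f), map_add, add_sub_add_comm]
  refine add_mem (key _ (sub_trunc_mem hω _ f)) ?_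
  rw [trunc, map_sum, ← Finset.sum_sub_distrib]
  refine Submodule.sum_mem _ fun P _ => ?_
  rw [map_smul, ← smul_sub, h.hom_ofPath]
  by_cases hP : pathWt ω P.2.2 < d
  · rw [hf _ _ _ hP, zero_smul]
    exact zero_mem _
  · exact Submodule.smul_mem _ _ (wtPow_mono (by omega) (hp _ _ P.2.2))

open Classical in
/-- The sum of the coefficients of all cycles of weight `d`. -/
noncomputable def cycleSum (hω : ∀ (i j : V) (a : i ⟶ j), 1 ≤ ω i j a)
    (d : ℕ) : CompletePathAlgebra k V →ₗ[k] k :=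
  ∑ P ∈ (pathsBelow hω (d + 1)).filter (fun P => P.1 = P.2.1 ∧ pathWt ω P.2.2 = d),
    coeffLM k P.2.2

theorem cycleSum_eq_zero (hω : ∀ (i j : V) (a : i ⟶ j), 1 ≤ ω i j a)
    {d : ℕ} {f : CompletePathAlgebra k V}
    (hf : ∀ (i : V) (p : Quiver.Path i i), pathWt ω p = d → f i i p = 0) :
    cycleSum hω d f = 0 := by
  classical
  rw [cycleSum, LinearMap.sum_apply]
  refine Finset.sum_eq_zero ?_
  rintro ⟨i, j, p⟩ hP
  obtain ⟨-, rfl : i = j, h⟩ := Finset.mem_filter.1 hP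
  exact hf i p h

theorem cycleSum_ofPath (hω : ∀ (i j : V) (a : i ⟶ j), 1 ≤ ω i j a)
    {i : V} (p : Quiver.Path i i) :
    cycleSum hω (pathWt ω p) (ofPath k p) = 1 := by
  classical
  rw [cycleSum, LinearMap.sum_apply, Finset.sum_eq_single ⟨i, i, p⟩]
  · simp
  · intro P _ hne
    exact ofPath_of_ne _ _ hne
  · intro h
    exact absurd (Finset.mem_filter.2 ⟨(mem_pathsBelow hω).2 (by simp), rfl, rfl⟩) h

theorem cycleSum_ofPath_of_ne (hω : ∀ (i j : V) (a : i ⟶ j), 1 ≤ ω i j a)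
    {d : ℕ} {i : V} (p : Quiver.Path i i) (h : pathWt ω p ≠ d) :
    cycleSum hω d (ofPath k p) = 0 := by
  refine cycleSum_eq_zero hω fun j q hq => ofPath_of_ne _ _ fun e => h ?_
  cases e
  exact hq

theorem cycleSum_eq_zero_of_mem (hω : ∀ (i j : V) (a : i ⟶ j), 1 ≤ ω i j a)
    {d e : ℕ} (hde : d < e) {f : CompletePathAlgebra k V}
    (hf : f ∈ wtPow k ω e) : cycleSum hω d f = 0 :=
  cycleSum_eq_zero hω fun i p hp => hf i i p (hp ▸ hde)

/-- If both products are cycles, they are rotations of each other and have equal weight. Otherwise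
each product is zero or an open path, which the functional ignores. -/
theorem cycleSum_ofPath_mul_comm (hω : ∀ (i j : V) (a : i ⟶ j), 1 ≤ ω i j a)
    (d : ℕ) {i j j' l : V} (p : Quiver.Path i j)
    (q : Quiver.Path j' l) : cycleSum hω d (ofPath k p * ofPath k q) =
      cycleSum hω d (ofPath k q * ofPath k p) := by
  have open_eq_zero : ∀ {i j : V} (p : Quiver.Path i j), i ≠ j →
      cycleSum hω d (ofPath k p) = 0 := by
    intro i j p h
    refine cycleSum_eq_zero hω fun m q _ => ofPath_of_ne _ _ fun e => h ?_
    cases e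
    rfl
  by_cases hj : j = j'
  · subst hj
    by_cases hi : l = i
    · subst hi
      rw [ofPath_mul_ofPath, ofPath_mul_ofPath]
      have e : pathWt ω (p.comp q) = pathWt ω (q.comp p) := by
        rw [pathWt_comp, pathWt_comp, add_comm]
      by_cases hd : pathWt ω (p.comp q) = d
      · subst hd
        rw [cycleSum_ofPath, e, cycleSum_ofPath]
      · rw [cycleSum_ofPath_of_ne hω _ hd, cycleSum_ofPath_of_ne hω _ (e ▸ hd)]
    · rw [ofPath_mul_ofPath, open_eq_zero _ (Ne.symm hi), ofPath_mul_ofPath_of_ne _ _ hi, map_zero]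
  · rw [ofPath_mul_ofPath_of_ne _ _ hj, map_zero]
    by_cases hi : l = i
    · subst hi
      rw [ofPath_mul_ofPath, open_eq_zero _ (Ne.symm hj)]
    · rw [ofPath_mul_ofPath_of_ne _ _ hi, map_zero]

/-- Terms of weight above `d` do not contribute, so both factors may be truncated, and bilinearity
reduces the identity to paths. -/
theorem cycleSum_mul_comm (hω : ∀ (i j : V) (a : i ⟶ j), 1 ≤ ω i j a)
    (d : ℕ) (f g : CompletePathAlgebra k V) :
    cycleSum hω d (f * g) = cycleSum hω d (g * f) := by
  have small : ∀ f ∈ wtPow k ω (d + 1), cycleSum hω d f = 0 :=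
    fun f hf => cycleSum_eq_zero_of_mem hω (Nat.lt_succ_self d) hf
  have reduce : ∀ f g : CompletePathAlgebra k V, cycleSum hω d (f * g) =
      cycleSum hω d (trunc hω (d + 1) f * trunc hω (d + 1) g) := by
    intro f g
    rw [← sub_eq_zero, ← map_sub]
    have e : f * g - trunc hω (d + 1) f * trunc hω (d + 1) g =
        (f - trunc hω (d + 1) f) * g + trunc hω (d + 1) f * (g - trunc hω (d + 1) g) := by
      noncomm_ring
    rw [e]
    exact small _ (add_mem (mul_mem_wtPow_left (sub_trunc_mem hω _ _) _)
      (mul_mem_wtPow_right _ (sub_trunc_mem hω _ _)))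
  rw [reduce f g, reduce g f]
  simp only [trunc, Finset.sum_mul_sum, map_sum, smul_mul_assoc, mul_smul_comm, map_smul]
  rw [Finset.sum_comm]
  refine Finset.sum_congr rfl fun P _ => Finset.sum_congr rfl fun Q _ => ?_
  rw [cycleSum_ofPath_mul_comm, smul_comm]

theorem cycleSum_eq_zero_of_mem_cycPow (hω : ∀ (i j : V) (a : i ⟶ j), 1 ≤ ω i j a)
    {d e : ℕ} (hde : d < e) {f : CompletePathAlgebra k V}
    (hf : f ∈ cycPow k ω e) : cycleSum hω d f = 0 := by
  obtain ⟨c, hc, g, hg, rfl⟩ := Submodule.mem_sup.1 hf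
  have : commutators k V ≤ LinearMap.ker (cycleSum hω d) := by
    refine Submodule.span_le.2 ?_
    rintro _ ⟨p, q, rfl⟩
    change cycleSum hω d (p * q - q * p) = 0
    rw [map_sub, cycleSum_mul_comm, sub_self]
  rw [map_add, cycleSum_eq_zero_of_mem hω hde hg, add_zero]
  exact this hc

end FiniteType

/-! ### Automorphisms that rescale the arrows. -/

section Scaling

variable {k : Type*} [CommRing k] {V : Type*} [Quiver V]

/-- The multiplicative extension to paths of a scaling of the arrows. -/
def pathScale (c : ∀ i j : V, (i ⟶ j) → kˣ) {i : V} : ∀ {j : V}, Quiver.Path i j → kˣ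
  | _, Quiver.Path.nil => 1
  | _, Quiver.Path.cons p a => pathScale c p * c _ _ a

theorem pathScale_comp (c : ∀ i j : V, (i ⟶ j) → kˣ) {i j l : V} (p : Quiver.Path i j)
    (q : Quiver.Path j l) : pathScale c (p.comp q) = pathScale c p * pathScale c q := by
  induction q with
  | nil => exact (mul_one _).symm
  | cons q a ih => rw [Quiver.Path.comp_cons, pathScale, ih, pathScale, mul_assoc]

/-- The automorphism that scales the arrows. -/
def scale (c : ∀ i j : V, (i ⟶ j) → kˣ) : CompletePathAlgebra k V ≃ₐ[k] CompletePathAlgebra k V :=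
  AlgEquiv.ofLinearEquiv
    { toFun := fun f i j p => (pathScale c p : k) * f i j p
      invFun := fun f i j p => ((pathScale c p)⁻¹ : kˣ) * f i j p
      map_add' := fun f g => by
        ext i j p
        exact mul_add _ _ _
      map_smul' := fun r f => by
        ext i j p
        exact mul_left_comm _ _ _
      left_inv := fun f => by
        ext i j p
        exact Units.inv_mul_cancel_left _ _
      right_inv := fun f => by
        ext i j p
        exact Units.mul_inv_cancel_left _ _ }
    (by
      ext i j p
      cases p with
      | nil => exact (one_mul _).trans rfl
      | cons p a => exact (mul_zero _).trans rfl)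
    (fun f g => by
      ext i j p
      change (pathScale c p : k) * (f * g) i j p = _
      rw [mul_coeff, mul_coeff, ← List.sum_map_mul_left]
      refine congrArg List.sum (List.map_congr_left fun s hs => ?_)
      rw [mem_splits] at hs
      rw [← hs, pathScale_comp, Units.val_mul]
      exact mul_mul_mul_comm _ _ _ _)

theorem scale_coeff (c : ∀ i j : V, (i ⟶ j) → kˣ) (f : CompletePathAlgebra k V) {i j : V}
    (p : Quiver.Path i j) : scale c f i j p = (pathScale c p : k) * f i j p := rfl

theorem scale_ofPath (c : ∀ i j : V, (i ⟶ j) → kˣ) {i j : V} (p : Quiver.Path i j) :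
    scale c (ofPath k p) = (pathScale c p : k) • ofPath k p := by
  ext i' j' q
  rw [scale_coeff, smul_coeff]
  by_cases h : (⟨i', j', q⟩ : Σ i j : V, Quiver.Path i j) = ⟨i, j, p⟩
  · cases h
    rfl
  · rw [ofPath_of_ne _ _ h, mul_zero, mul_zero]

theorem scale_idem (c : ∀ i j : V, (i ⟶ j) → kˣ) (v : V) : scale c (idem k v) = idem k v := by
  rw [idem, scale_ofPath, pathScale, Units.val_one, one_smul]

theorem scale_ofArrow (c : ∀ i j : V, (i ⟶ j) → kˣ) {i j : V} (a : i ⟶ j) :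
    scale c (ofArrow k a) = (c i j a : k) • ofArrow k a := by
  rw [ofArrow, scale_ofPath, Quiver.Hom.toPath, pathScale, pathScale, one_mul]

theorem scale_mem_wtPow (c : ∀ i j : V, (i ⟶ j) → kˣ) {ω : ∀ i j : V, (i ⟶ j) → ℕ} {d : ℕ}
    {f : CompletePathAlgebra k V} (hf : f ∈ wtPow k ω d) : scale c f ∈ wtPow k ω d := by
  intro i j p hp
  rw [scale_coeff, hf i j p hp, mul_zero]

end Scaling

end CompletePathAlgebra

/-! ### Cycles on the quiver `Q_{n,I}` -/

open CompletePathAlgebra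

section Cycles

variable {n : ℕ} {I : Finset (Fin n)}

theorem QVertex.ext_val {v w : QVertex n I} (h : v.num.val = w.num.val) : v = w := by
  obtain ⟨v⟩ := v
  obtain ⟨w⟩ := w
  exact congrArg QVertex.mk (Fin.ext h)

instance : Finite (QVertex n I) :=
  Finite.of_injective (fun v => v.num) fun _ _ h => QVertex.ext_val (congrArg Fin.val h)

/-- The loop at `v`. -/
abbrev loopArrow (v : QVertex n I) (hv : v.num ∉ I) : v ⟶ v := QArrow.loop v hv

/-- The arrow to the right. -/
abbrev rightArrow (v w : QVertex n I) (h : v.num.val + 1 = w.num.val) : v ⟶ w :=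
  QArrow.right v w h

/-- The arrow to the left. -/
abbrev leftArrow (v w : QVertex n I) (h : v.num.val + 1 = w.num.val) : w ⟶ v :=
  QArrow.left v w h

instance (v w : QVertex n I) : Finite (v ⟶ w) := by
  let tag : ∀ v w : QVertex n I, QArrow n I v w → Fin 3 := fun _ _ a =>
    match a with
    | QArrow.loop _ _ => 0
    | QArrow.right _ _ _ => 1
    | QArrow.left _ _ _ => 2
  refine Finite.of_injective (tag v w) fun a b h => ?_
  rcases a with ⟨_, _⟩ | ⟨_, _, _⟩ | ⟨_, _, _⟩ <;> rcases b with ⟨_, _⟩ | ⟨_, _, _⟩ | ⟨_, _, _⟩ <;>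
    first | rfl | simp [tag] at h

/-- The weight of an arrow: with it, `x_i` has weight `2 (4 n + 1 + i)`. -/
def arrowWeight : ∀ v w : QVertex n I, (v ⟶ w) → ℕ
  | _, _, QArrow.loop v _ => 2 * (4 * n + 1 + 2 * v.num.val)
  | _, _, QArrow.right v _ _ => 4 * n + 1 + (2 * v.num.val + 1)
  | _, _, QArrow.left v _ _ => 4 * n + 1 + (2 * v.num.val + 1)

theorem one_le_arrowWeight (v w : QVertex n I) (a : v ⟶ w) : 1 ≤ arrowWeight v w a := by
  rcases a with ⟨v, hv⟩ | ⟨v, w, h⟩ | ⟨v, w, h⟩ <;> simp only [arrowWeight] <;> omega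

theorem arrowWeight_le (v w : QVertex n I) (a : v ⟶ w) : arrowWeight v w a ≤ 20 * n + 10 := by
  have hv := v.num.isLt
  have hw := w.num.isLt
  rcases a with ⟨v, hv⟩ | ⟨v, w, h⟩ | ⟨v, w, h⟩ <;> simp only [arrowWeight] <;> omega

/-- The weight of a path. -/
abbrev wt {v w : QVertex n I} (p : Quiver.Path v w) : ℕ := pathWt arrowWeight p

theorem qDegree_comp {u v w : QVertex n I} (p : Quiver.Path u v) (q : Quiver.Path v w) :
    qDegree (p.comp q) = qDegree p + qDegree q := by
  induction q with
  | nil => rfl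
  | cons q a ih =>
    rw [Quiver.Path.comp_cons]
    rcases a with ⟨_, _⟩ | ⟨_, _, _⟩ | ⟨_, _, _⟩ <;> simp only [qDegree, ih] <;> omega

/-- The multiple of the vertex number acts as a height: it credits a right arrow with the share that
the matching left arrow carries, so the bound holds arrow by arrow. On a cycle the heights cancel.
The same device with slope 6n gives `wt_le_degree`. -/
theorem degree_le_wt {v w : QVertex n I} (p : Quiver.Path v w) :
    2 * (4 * n + 1) * qDegree p + (4 * n + 1) * v.num.val ≤ wt p + (4 * n + 1) * w.num.val := by
  induction p with
  | nil => simp [qDegree]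
  | cons p a ih =>
    rcases a with ⟨v, hv⟩ | ⟨v, w, h⟩ | ⟨v, w, h⟩ <;>
      simp only [qDegree, wt, pathWt_cons, arrowWeight] at ih ⊢
    · nlinarith
    · rw [← h]; nlinarith
    · rw [← h] at ih; nlinarith

theorem wt_le_degree {v w : QVertex n I} (p : Quiver.Path v w) :
    wt p + (6 * n) * w.num.val ≤ 2 * (6 * n) * qDegree p + (6 * n) * v.num.val := by
  induction p with
  | nil => simp [qDegree]
  | @cons y z p a ih =>
    have hy := y.num.isLt
    have hz := z.num.isLt
    rcases a with ⟨_, hv⟩ | ⟨_, _, h⟩ | ⟨_, _, h⟩ <;>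
      simp only [qDegree, wt, pathWt_cons, arrowWeight] at ih ⊢
    · nlinarith
    · rw [← h] at hz ⊢
      nlinarith
    · rw [← h] at ih hy
      nlinarith

/-- Closed paths of which one is a rotation of the other, up to commutators. -/
structure CycRel {u v : QVertex n I} (c : Quiver.Path u u) (d : Quiver.Path v v) : Prop where
  comm : ofPath ℂ c - ofPath ℂ d ∈ commutators ℂ (QVertex n I)
  wt_eq : wt c = wt d
  degree_eq : qDegree c = qDegree d
  length_eq : c.length = d.length

theorem CycRel.refl {u : QVertex n I} (c : Quiver.Path u u) : CycRel c c :=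
  ⟨by rw [sub_self]; exact zero_mem _, rfl, rfl, rfl⟩

theorem CycRel.trans {u v w : QVertex n I} {c : Quiver.Path u u} {d : Quiver.Path v v}
    {e : Quiver.Path w w} (h : CycRel c d) (h' : CycRel d e) : CycRel c e :=
  ⟨by simpa using add_mem h.comm h'.comm, h.wt_eq.trans h'.wt_eq,
    h.degree_eq.trans h'.degree_eq, h.length_eq.trans h'.length_eq⟩

theorem CycRel.rotate {u v : QVertex n I} (q : Quiver.Path u v) (r : Quiver.Path v u) :
    CycRel (q.comp r) (r.comp q) where
  comm := by
    rw [← ofPath_mul_ofPath, ← ofPath_mul_ofPath]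
    exact mul_sub_mul_mem_commutators _ _
  wt_eq := by rw [wt, wt, pathWt_comp, pathWt_comp, add_comm]
  degree_eq := by rw [qDegree_comp, qDegree_comp, add_comm]
  length_eq := by rw [Quiver.Path.length_comp, Quiver.Path.length_comp, add_comm]

theorem CycRel.cycEquiv {u v : QVertex n I} {c : Quiver.Path u u} {d : Quiver.Path v v}
    (h : CycRel c d) : CycEquiv (ofPath ℂ c) (ofPath ℂ d) :=
  fun m => ⟨_, h.comm, by rw [sub_self]; exact zero_mem _⟩

/-- The smallest number of a vertex on a path. -/
def minNum {u : QVertex n I} : ∀ {v : QVertex n I}, Quiver.Path u v → ℕ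
  | _, Quiver.Path.nil => u.num.val
  | v, Quiver.Path.cons p _ => min (minNum p) v.num.val

theorem minNum_le_target {u v : QVertex n I} (p : Quiver.Path u v) : minNum p ≤ v.num.val := by
  cases p with
  | nil => exact le_rfl
  | cons p a => exact min_le_right _ _

theorem minNum_comp {u v w : QVertex n I} (p : Quiver.Path u v) (q : Quiver.Path v w) :
    minNum (p.comp q) = min (minNum p) (minNum q) := by
  induction q with
  | nil => exact (min_eq_left (minNum_le_target p)).symm
  | cons q a ih => rw [Quiver.Path.comp_cons, minNum, ih, minNum, min_assoc]

theorem exists_comp_eq_minNum {u v : QVertex n I} (p : Quiver.Path u v) :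
    ∃ (x : QVertex n I) (q : Quiver.Path u x) (r : Quiver.Path x v),
      p = q.comp r ∧ x.num.val = minNum p := by
  induction p with
  | nil => exact ⟨u, Quiver.Path.nil, Quiver.Path.nil, rfl, rfl⟩
  | @cons v w p a ih =>
    obtain ⟨x, q, r, rfl, hx⟩ := ih
    rw [minNum]
    rcases le_total (minNum (q.comp r)) w.num.val with h | h
    · exact ⟨x, q, r.cons a, rfl, by rw [hx, min_eq_left h]⟩
    · exact ⟨w, (q.comp r).cons a, Quiver.Path.nil, rfl, by rw [min_eq_right h]⟩

/-- A cycle based at its leftmost vertex can leave it only by a loop or to the right, and return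
only by a loop or from the right. -/
theorem exists_rotation_minNum {u : QVertex n I} (c : Quiver.Path u u) :
    ∃ (x : QVertex n I) (d : Quiver.Path x x), CycRel c d ∧ x.num.val = minNum d := by
  obtain ⟨x, q, r, rfl, hx⟩ := exists_comp_eq_minNum c
  refine ⟨x, r.comp q, CycRel.rotate q r, ?_⟩
  rw [hx, minNum_comp, minNum_comp, min_comm]

namespace QIndex

/-- `j` is the successor of `i`. -/
inductive Adj : QIndex n I → QIndex n I → Prop
  | loopEdge (v w : QVertex n I) (hv : v.num ∉ I) (h : v.num.val + 1 = w.num.val) :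
    Adj (loop v hv) (edge v w h)
  | edgeLoop (u v : QVertex n I) (h : u.num.val + 1 = v.num.val) (hv : v.num ∉ I) :
    Adj (edge u v h) (loop v hv)
  | edgeEdge (u v w : QVertex n I) (h : u.num.val + 1 = v.num.val)
    (h' : v.num.val + 1 = w.num.val) (hv : v.num ∈ I) : Adj (edge u v h) (edge v w h')

theorem isNext_iff_adj {i j : QIndex n I} : i.IsNext j ↔ Adj i j := by
  constructor
  · rintro ⟨hlt, hno⟩
    -- Only loops can be missing: every pair of neighbouring vertices gives an edge index, and no
    -- such index may lie strictly between `i` and its successor.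
    have noEdge : ∀ (m : ℕ) (hm : m + 1 < n),
        ¬ (i.pos < 2 * m + 1 ∧ 2 * m + 1 < j.pos) := fun m hm =>
      hno (edge ⟨⟨m, by omega⟩⟩ ⟨⟨m + 1, hm⟩⟩ rfl)
    rcases i with ⟨v, hv⟩ | ⟨u, v, hu⟩ <;> rcases j with ⟨v', hv'⟩ | ⟨v', w', hw'⟩ <;>
      simp only [pos] at hlt noEdge hno
    · have := v'.num.isLt
      exact absurd ⟨by omega, by omega⟩ (noEdge v.num.val (by omega))
    · have h : v = v' := by
        apply QVertex.ext_val
        by_contra hne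
        have := v'.num.isLt
        exact absurd ⟨by omega, by omega⟩ (noEdge v.num.val (by omega))
      subst h
      exact Adj.loopEdge _ _ _ _
    · have h : v = v' := by
        apply QVertex.ext_val
        by_contra hne
        have := v'.num.isLt
        exact absurd ⟨by omega, by omega⟩ (noEdge v.num.val (by omega))
      subst h
      exact Adj.edgeLoop _ _ _ _
    · have h : v = v' := by
        apply QVertex.ext_val
        by_contra hne
        have := v'.num.isLt
        exact absurd ⟨by omega, by omega⟩ (noEdge v.num.val (by omega))
      subst h
      by_cases hv : v.num ∈ I
      · exact Adj.edgeEdge _ _ _ _ _ hv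
      · exact absurd ⟨by dsimp only; omega, by dsimp only; omega⟩ (hno (loop v hv))
  · intro h
    cases h with
    | loopEdge v w hv h =>
      refine ⟨by simp only [pos]; omega, fun l => ?_⟩
      cases l <;> simp only [pos] <;> omega
    | edgeLoop u v h hv =>
      refine ⟨by simp only [pos]; omega, fun l => ?_⟩
      cases l <;> simp only [pos] <;> omega
    | edgeEdge u v w h h' hv =>
      refine ⟨by simp only [pos]; omega, fun l => ?_⟩
      cases l with
      | edge => simp only [pos]; omega
      | loop v' hv' =>
        simp only [pos]
        intro hl
        have : v' = v := QVertex.ext_val (by omega)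
        subst this
        exact hv' hv

/-- The source of `a_i`. -/
def src : QIndex n I → QVertex n I
  | loop v _ => v
  | edge v _ _ => v

/-- The target of `a_i`. -/
def tgt : QIndex n I → QVertex n I
  | loop v _ => v
  | edge _ w _ => w

/-- The path `a_i`. -/
def aPath : ∀ i : QIndex n I, Quiver.Path i.src i.tgt
  | loop v hv => (loopArrow v hv).toPath
  | edge v w h => (rightArrow v w h).toPath

/-- The path `b_i`. -/
def bPath : ∀ i : QIndex n I, Quiver.Path i.tgt i.src
  | loop _ _ => Quiver.Path.nil
  | edge v w h => (leftArrow v w h).toPath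

theorem ofPath_aPath (i : QIndex n I) : ofPath ℂ i.aPath = i.a := by cases i <;> rfl

theorem ofPath_bPath (i : QIndex n I) : ofPath ℂ i.bPath = i.b := by cases i <;> rfl

/-- The path `x_i`. -/
def xPath (i : QIndex n I) : Quiver.Path i.src i.src := i.aPath.comp i.bPath

/-- The path `x_i'`. -/
def x'Path (i : QIndex n I) : Quiver.Path i.tgt i.tgt := i.bPath.comp i.aPath

theorem ofPath_xPath (i : QIndex n I) : ofPath ℂ i.xPath = i.x := by
  rw [xPath, ← ofPath_mul_ofPath, ofPath_aPath, ofPath_bPath, x]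

theorem ofPath_x'Path (i : QIndex n I) : ofPath ℂ i.x'Path = i.x' := by
  rw [x'Path, ← ofPath_mul_ofPath, ofPath_aPath, ofPath_bPath, x']

/-- The weight of `x_i`. -/
def xWeight (i : QIndex n I) : ℕ := 2 * (4 * n + 1 + i.pos)

theorem wt_xPath (i : QIndex n I) : wt i.xPath = i.xWeight := by
  cases i with
  | loop v hv =>
    change 0 + 2 * (4 * n + 1 + 2 * v.num.val) = 2 * (4 * n + 1 + 2 * v.num.val)
    omega
  | edge v w h =>
    change 0 + (4 * n + 1 + (2 * v.num.val + 1)) + (4 * n + 1 + (2 * v.num.val + 1)) =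
      2 * (4 * n + 1 + (2 * v.num.val + 1))
    omega

theorem wt_x'Path (i : QIndex n I) : wt i.x'Path = i.xWeight := by
  rw [← wt_xPath, wt, wt, x'Path, xPath, pathWt_comp, pathWt_comp, add_comm]

theorem qDegree_aPath (i : QIndex n I) : qDegree i.aPath = 1 := by cases i <;> rfl

theorem qDegree_bPath (i : QIndex n I) : qDegree i.bPath = 0 := by cases i <;> rfl

theorem qDegree_x'Path (i : QIndex n I) : qDegree i.x'Path = 1 := by
  rw [x'Path, qDegree_comp, qDegree_aPath, qDegree_bPath]

theorem Adj.tgt_eq_src {i j : QIndex n I} (h : Adj i j) : i.tgt = j.src := by cases h <;> rfl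

theorem Adj.pos_lt_pos {i j : QIndex n I} (h : Adj i j) : i.pos < j.pos :=
  (isNext_iff_adj.2 h).1

theorem Adj.left_unique {i i' j : QIndex n I} (h : Adj i j) (h' : Adj i' j) : i = i' := by
  have h1 := (isNext_iff_adj.2 h)
  have h2 := (isNext_iff_adj.2 h')
  apply pos_injective
  by_contra hne
  rcases Nat.lt_or_gt_of_ne hne with hlt | hlt
  · exact h1.2 i' ⟨hlt, h2.1⟩
  · exact h2.2 i ⟨hlt, h1.1⟩

theorem Adj.right_unique {i j j' : QIndex n I} (h : Adj i j) (h' : Adj i j') : j = j' := by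
  have h1 := (isNext_iff_adj.2 h)
  have h2 := (isNext_iff_adj.2 h')
  apply pos_injective
  by_contra hne
  rcases Nat.lt_or_gt_of_ne hne with hlt | hlt
  · exact h2.2 j ⟨h1.1, hlt⟩
  · exact h1.2 j' ⟨h2.1, hlt⟩

end QIndex

open QIndex

/-- The path contains `b_j x_i'` for some index `i` with successor `j`. -/
inductive HasPat {z : QVertex n I} : ∀ {y : QVertex n I}, Quiver.Path z y → Prop
  | leftLoop (v w : QVertex n I) (h : v.num.val + 1 = w.num.val) (hv : v.num ∉ I)
    (q : Quiver.Path z w) : HasPat ((q.cons (leftArrow v w h)).cons (loopArrow v hv))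
  | leftRight (v w : QVertex n I) (h : v.num.val + 1 = w.num.val) (hw : w.num ∉ I)
    (q : Quiver.Path z w) : HasPat ((q.cons (leftArrow v w h)).cons (rightArrow v w h))
  | leftLeftRight (u v w : QVertex n I) (h : u.num.val + 1 = v.num.val)
    (h' : v.num.val + 1 = w.num.val) (hv : v.num ∈ I) (q : Quiver.Path z w) :
    HasPat (((q.cons (leftArrow v w h')).cons (leftArrow u v h)).cons (rightArrow u v h))
  | cons {y y' : QVertex n I} (q : Quiver.Path z y) (a : y ⟶ y') : HasPat q → HasPat (q.cons a)

/-- The three shapes are b_j x_i' for the three kinds of adjacency. For a loop followed by an edge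
it is left, loop; for an edge followed by a loop b_j is lazy and it is left, right; for two edges at
a vertex without loop it is left, left, right. -/
theorem HasPat.exists_comp {z y : QVertex n I} {q : Quiver.Path z y} (hq : HasPat q) :
    ∃ i j : QIndex n I, Adj i j ∧ ∃ (s : Quiver.Path z j.tgt) (π : Quiver.Path j.tgt i.tgt)
      (t : Quiver.Path i.tgt y), ofPath ℂ π = j.b * i.x' ∧ q = s.comp (π.comp t) := by
  induction hq with
  | leftLoop v w h hv q =>
    refine ⟨_, _, Adj.loopEdge v w hv h, q,
      ((leftArrow v w h).toPath).comp ((loopArrow v hv).toPath), Quiver.Path.nil, ?_, rfl⟩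
    have e : (loop v hv).x' = ofArrow ℂ (loopArrow v hv) := idem_mul_ofPath _
    rw [e]
    exact (ofPath_mul_ofPath _ _).symm
  | leftRight v w h hw q =>
    refine ⟨_, _, Adj.edgeLoop v w h hw, q,
      ((leftArrow v w h).toPath).comp ((rightArrow v w h).toPath), Quiver.Path.nil, ?_, rfl⟩
    have e : (edge v w h).x' = ofPath ℂ ((leftArrow v w h).toPath.comp (rightArrow v w h).toPath) :=
      ofPath_mul_ofPath _ _
    rw [e]
    exact (idem_mul_ofPath _).symm
  | leftLeftRight u v w h h' hv q =>
    refine ⟨_, _, Adj.edgeEdge u v w h h' hv, q, ((leftArrow v w h').toPath).comp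
      (((leftArrow u v h).toPath).comp ((rightArrow u v h).toPath)), Quiver.Path.nil, ?_, rfl⟩
    have e : (edge u v h).x' = ofPath ℂ ((leftArrow u v h).toPath.comp (rightArrow u v h).toPath) :=
      ofPath_mul_ofPath _ _
    rw [e]
    exact (ofPath_mul_ofPath _ _).symm
  | cons q a _ ih =>
    obtain ⟨i, j, hij, s, π, t, hπ, rfl⟩ := ih
    exact ⟨i, j, hij, s, π, t.cons a, hπ, rfl⟩

/-- The path ends at a vertex that it never goes below, so no right arrow can come last. A loop
there after a left arrow is a pattern; hence in the absence of patterns a final loop is preceded by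
nothing but loops. -/
theorem HasPat.or_loops_or_left {z u : QVertex n I} (q : Quiver.Path z u)
    (hq : u.num.val ≤ minNum q) :
    HasPat q ∨ (z = u ∧ q.length = 0) ∨
      (z = u ∧ ∃ (hu : u.num ∉ I) (m : ℕ), ofPath ℂ q = (loop u hu).x ^ (m + 1)) ∨
      ∃ (v : QVertex n I) (h : u.num.val + 1 = v.num.val) (q' : Quiver.Path z v),
        q = q'.cons (leftArrow u v h) := by
  induction q with
  | nil => exact Or.inr (Or.inl ⟨rfl, rfl⟩)
  | @cons v w q a ih =>
    rcases a with ⟨_, hv⟩ | ⟨_, _, h⟩ | ⟨_, _, h⟩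
    · have hx : (loop v hv).x = ofArrow ℂ (loopArrow v hv) := ofPath_mul_idem _
      rcases ih (hq.trans (min_le_left _ _)) with h | ⟨hz, h⟩ | ⟨hz, hv', m, h⟩ | ⟨w, h, q', rfl⟩
      · exact Or.inl (HasPat.cons _ _ h)
      · subst hz
        obtain rfl := Quiver.Path.eq_nil_of_length_zero q h
        refine Or.inr (Or.inr (Or.inl ⟨rfl, hv, 0, ?_⟩))
        rw [zero_add, pow_one, hx]
        rfl
      · refine Or.inr (Or.inr (Or.inl ⟨hz, hv, m + 1, ?_⟩))
        rw [pow_succ, ← h, hx]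
        exact ofPath_cons _ _
      · exact Or.inl (HasPat.leftLoop _ _ _ _ _)
    · have h1 := (hq.trans (min_le_left _ _)).trans (minNum_le_target q)
      omega
    · exact Or.inr (Or.inr (Or.inr ⟨v, h, q, rfl⟩))

/-- As `v` has no loop, the path arrives there from `u` or from the right. If it arrives from `u`
without a pattern, then its last two arrows are v → u → v. They are split off, hence the induction
on length; a left arrow into `v` just before them would be a pattern. -/
theorem HasPat.or_zigzag_or_left {u v : QVertex n I} (h : u.num.val + 1 = v.num.val)
    (hv : v.num ∈ I) : ∀ (N : ℕ) (q : Quiver.Path v v), q.length ≤ N → u.num.val ≤ minNum q →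
    HasPat q ∨ (∃ m : ℕ, ofPath ℂ q = idem ℂ v * (edge u v h).x' ^ m) ∨
      ∃ (w : QVertex n I) (h' : v.num.val + 1 = w.num.val) (q' : Quiver.Path v w),
        q = q'.cons (leftArrow v w h') := by
  intro N
  induction N with
  | zero =>
    intro q hN _
    obtain rfl := Quiver.Path.eq_nil_of_length_zero q (by omega)
    exact Or.inr (Or.inl ⟨0, by rw [pow_zero, mul_one]; rfl⟩)
  | succ N ih =>
    intro q hN hq
    cases q with
    | nil => exact Or.inr (Or.inl ⟨0, by rw [pow_zero, mul_one]; rfl⟩)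
    | @cons t _ q a =>
      rcases a with ⟨_, hv'⟩ | ⟨_, _, ht⟩ | ⟨_, _, h'⟩
      · exact absurd hv hv'
      · obtain rfl : t = u := QVertex.ext_val (by omega)
        rcases HasPat.or_loops_or_left q (hq.trans (min_le_left _ _)) with
          hp | ⟨hz, -⟩ | ⟨hz, -⟩ | ⟨v', hv', q', rfl⟩
        · exact Or.inl (HasPat.cons _ _ hp)
        · subst hz
          omega
        · subst hz
          omega
        · obtain rfl : v' = v := QVertex.ext_val (by omega)
          rcases ih q' (by simp only [Quiver.Path.length_cons] at hN; omega)
            ((hq.trans (min_le_left _ _)).trans (min_le_left _ _)) with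
            hp | ⟨m, hm⟩ | ⟨w, h', q'', rfl⟩
          · exact Or.inl (HasPat.cons _ _ (HasPat.cons _ _ hp))
          · refine Or.inr (Or.inl ⟨m + 1, ?_⟩)
            rw [pow_succ, ← mul_assoc, ← hm, x', b, a, ← mul_assoc]
            exact (ofPath_cons _ _).trans (congrArg (· * _) (ofPath_cons _ _))
          · exact Or.inl (HasPat.leftLeftRight _ _ _ _ _ hv _)
      · exact Or.inr (Or.inr ⟨t, h', q, rfl⟩)

/-- A cycle is, up to rotation, a power of some `x_i`, or it contains `b_j x_i'` for some index `i`
with successor `j`. -/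
theorem pure_or_hasPat {u : QVertex n I} (c : Quiver.Path u u) (hc : c.length ≠ 0) :
    ∃ (v : QVertex n I) (d : Quiver.Path v v), CycRel c d ∧
      (HasPat d ∨ ∃ (i : QIndex n I) (m : ℕ),
        ofPath ℂ d - i.x ^ (m + 1) ∈ commutators ℂ (QVertex n I)) := by
  obtain ⟨u, c', hcc, hu⟩ := exists_rotation_minNum c
  rw [hcc.length_eq] at hc
  rcases HasPat.or_loops_or_left c' hu.le with hp | ⟨-, h0⟩ | ⟨-, hu', m, hm⟩ | ⟨v, h, q, rfl⟩
  · exact ⟨u, c', hcc, Or.inl hp⟩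
  · exact absurd h0 hc
  · exact ⟨u, c', hcc, Or.inr ⟨_, m, by rw [hm, sub_self]; exact zero_mem _⟩⟩
  · have hq0 : q.length ≠ 0 := by
      intro h0
      obtain rfl := Quiver.Path.eq_of_length_zero q h0
      omega
    obtain ⟨t, a, r, rfl, -⟩ := (Quiver.Path.length_ne_zero_iff_eq_comp q).1 hq0
    -- The first arrow out of `u` is rotated behind the final arrow v → u. A loop yields a pattern
    -- at once, a right arrow yields v → u → v at the end, and a left arrow contradicts the
    -- minimality of `u`.
    rcases a with ⟨_, hu'⟩ | ⟨_, _, h'⟩ | ⟨_, _, h'⟩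
    · refine ⟨u, _, hcc.trans (CycRel.rotate (loopArrow u hu').toPath (r.cons (leftArrow u v h))),
        Or.inl ?_⟩
      exact HasPat.leftLoop _ _ _ _ _
    · obtain rfl : v = t := QVertex.ext_val (by omega)
      have hrot := hcc.trans (CycRel.rotate (rightArrow u v h').toPath (r.cons (leftArrow u v h)))
      refine ⟨v, _, hrot, ?_⟩
      by_cases hv : v.num ∈ I
      · have hmin : u.num.val ≤ minNum r := by
          rw [hu, minNum, minNum_comp]
          omega
        rcases HasPat.or_zigzag_or_left h hv _ r le_rfl hmin with
          hp | ⟨m, hm⟩ | ⟨w, h', q', rfl⟩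
        · exact Or.inl (HasPat.cons _ _ (HasPat.cons _ _ hp))
        · refine Or.inr ⟨edge u v h, m, ?_⟩
          have e : ofPath ℂ ((r.cons (leftArrow u v h)).comp (rightArrow u v h').toPath) =
              (edge u v h).x' ^ (m + 1) := by
            have e1 : ofPath ℂ ((r.cons (leftArrow u v h)).comp (rightArrow u v h').toPath) =
                ofPath ℂ r * (edge u v h).x' := by
              rw [x', b, a, ← mul_assoc]
              exact (ofPath_cons _ _).trans (congrArg (· * _) (ofPath_cons _ _))
            rw [e1, hm, mul_assoc, ← pow_succ, pow_succ', x', b, a, mul_assoc, ← mul_assoc (idem ℂ v)]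
            congr 1
            exact idem_mul_ofPath _
          -- This is a(ba)^m b = (ab)^(m+1); it shows that powers of x' are rotations of powers of
          -- x.
          have key : ∀ m : ℕ, (edge u v h).a * (edge u v h).x' ^ m * (edge u v h).b =
              (edge u v h).x ^ (m + 1) := by
            intro m
            induction m with
            | zero => rw [pow_zero, mul_one, zero_add, pow_one, x]
            | succ m ih => rw [pow_succ (x _) (m + 1), ← ih, pow_succ, x, x']; noncomm_ring
          rw [e, ← key, pow_succ', x', mul_assoc, ← x']
          exact mul_sub_mul_mem_commutators _ _
        · exact Or.inl (HasPat.leftLeftRight _ _ _ _ _ hv _)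
      · exact Or.inl (HasPat.leftRight _ _ _ hv _)
    · have h1 : minNum (((leftArrow t u h').toPath.comp r).cons (leftArrow u v h)) ≤ t.num.val := by
        rw [minNum, minNum_comp, Quiver.Hom.toPath, minNum]
        omega
      have h2 : u.num.val ≤ t.num.val := hu.le.trans h1
      omega

end Cycles

open QIndex

/-! ### Reduction of cycles to normal forms, and the cycles of degree two. -/

section Reduction

variable {n : ℕ} {I : Finset (Fin n)}

/-- If the weights differed, the trace at the weight of `c` would take the value 1 on the
difference, yet it kills commutators. Keeping `ω` general lets the constant weight 1 compare lengths
too. -/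
theorem pathWt_eq_of_sub_mem_commutators {ω : ∀ v w : QVertex n I, (v ⟶ w) → ℕ}
    (hω : ∀ v w a, 1 ≤ ω v w a) {u v : QVertex n I} {c : Quiver.Path u u} {d : Quiver.Path v v}
    (h : ofPath ℂ c - ofPath ℂ d ∈ commutators ℂ (QVertex n I)) : pathWt ω c = pathWt ω d := by
  by_contra hne
  have h0 := cycleSum_eq_zero_of_mem_cycPow hω (Nat.lt_succ_self (pathWt ω c))
    (commutators_le_cycPow _ h)
  rw [map_sub, cycleSum_ofPath, cycleSum_ofPath_of_ne hω d (Ne.symm hne), sub_zero] at h0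
  exact one_ne_zero h0

theorem pathWt_one {u v : QVertex n I} (p : Quiver.Path u v) :
    pathWt (fun _ _ _ => 1) p = p.length := by
  induction p with
  | nil => rfl
  | cons p a ih => rw [pathWt_cons, ih, Quiver.Path.length_cons]

theorem length_eq_of_sub_mem_commutators {u v : QVertex n I} {c : Quiver.Path u u}
    {d : Quiver.Path v v} (h : ofPath ℂ c - ofPath ℂ d ∈ commutators ℂ (QVertex n I)) :
    c.length = d.length := by
  rw [← pathWt_one, ← pathWt_one]
  exact pathWt_eq_of_sub_mem_commutators (fun _ _ _ => le_rfl) h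

theorem exists_path_x_pow (i : QIndex n I) (m : ℕ) : ∃ p : Quiver.Path i.src i.src,
    ofPath ℂ p = i.x ^ (m + 1) ∧ wt p = (m + 1) * i.xWeight ∧
      p.length = (m + 1) * i.xPath.length := by
  induction m with
  | zero => exact ⟨i.xPath, by rw [zero_add, pow_one, ofPath_xPath],
      by rw [zero_add, one_mul, wt_xPath], by rw [zero_add, one_mul]⟩
  | succ m ih =>
    obtain ⟨p, hp, hw, hl⟩ := ih
    refine ⟨p.comp i.xPath, ?_, ?_, ?_⟩
    · rw [← ofPath_mul_ofPath, hp, ofPath_xPath, pow_succ _ (m + 1)]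
    · rw [wt, pathWt_comp]
      change wt p + wt i.xPath = _
      rw [hw, wt_xPath]
      ring
    · rw [Quiver.Path.length_comp, hl]
      ring

theorem exists_path_x'_mul_x {i j : QIndex n I} (h : i.tgt = j.src) :
    ∃ p : Quiver.Path j.src j.src, ofPath ℂ p = i.x' * j.x ∧ wt p = i.xWeight + j.xWeight ∧
      p.length = i.x'Path.length + j.xPath.length := by
  obtain ⟨q, hq, hw, hl⟩ : ∃ q : Quiver.Path j.src j.src, ofPath ℂ q = i.x' ∧
      wt q = i.xWeight ∧ q.length = i.x'Path.length := by
    rw [← h]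
    exact ⟨i.x'Path, ofPath_x'Path i, wt_x'Path i, rfl⟩
  refine ⟨q.comp j.xPath, ?_, ?_, ?_⟩
  · rw [← ofPath_mul_ofPath, hq, ofPath_xPath]
  · rw [wt, pathWt_comp]
    change wt q + wt j.xPath = _
    rw [hw, wt_xPath]
  · rw [Quiver.Path.length_comp, hl]

theorem QIndex.Adj.wt_pat {i j : QIndex n I} (h : Adj i j) {π : Quiver.Path j.tgt i.tgt}
    (hπ : ofPath ℂ π = j.b * i.x') :
    wt π = wt j.bPath + i.xWeight ∧ qDegree π = 1 := by
  rw [← ofPath_bPath, ← ofPath_x'Path] at hπ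
  rw [← wt_x'Path]
  -- The source of a_j and the target of a_i agree only propositionally, so the vertex is
  -- generalized before the paths are composed.
  have key : ∀ (y : QVertex n I) (hy : j.src = y) (q : Quiver.Path y i.tgt),
      ofPath ℂ π = ofPath ℂ j.bPath * ofPath ℂ q →
        wt π = wt j.bPath + wt q ∧ qDegree π = qDegree q := by
    rintro y rfl q hq
    rw [ofPath_mul_ofPath] at hq
    rw [ofPath_injective hq]
    exact ⟨pathWt_comp _ _ _, by rw [qDegree_comp, qDegree_bPath, zero_add]⟩
  have := key _ h.tgt_eq_src.symm _ hπ
  rwa [qDegree_x'Path] at this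

/-- The form of `pure_or_hasPat` used for elimination: the cycle is rotated until the pattern stands
last, and the weight, degree and length data are carried along. -/
theorem cycle_reduction {u : QVertex n I} (c : Quiver.Path u u) (hc : c.length ≠ 0) :
    (∃ (i : QIndex n I) (m : ℕ), ofPath ℂ c - i.x ^ (m + 1) ∈ commutators ℂ (QVertex n I) ∧
      wt c = (m + 1) * i.xWeight ∧ c.length = (m + 1) * i.xPath.length) ∨
    ∃ i j : QIndex n I, Adj i j ∧ ∃ p : Quiver.Path i.tgt j.tgt,
      ofPath ℂ c - ofPath ℂ p * (j.b * i.x') ∈ commutators ℂ (QVertex n I) ∧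
      wt c = wt p + (wt j.bPath + i.xWeight) ∧ qDegree c = qDegree p + 1 := by
  obtain ⟨v, d, hcd, hp | ⟨i, m, hd⟩⟩ := pure_or_hasPat c hc
  · right
    obtain ⟨i, j, hij, s, π, t, hπ, rfl⟩ := hp.exists_comp
    have hrot := hcd.trans (CycRel.rotate s (π.comp t))
    rw [Quiver.Path.comp_assoc] at hrot
    have hrot := hrot.trans (CycRel.rotate π (t.comp s))
    have hw := hrot.wt_eq
    have hd := hrot.degree_eq
    have hm := hrot.comm
    obtain ⟨h1, h2⟩ := hij.wt_pat hπ
    rw [wt, wt, pathWt_comp] at hw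
    rw [qDegree_comp, h2] at hd
    rw [← ofPath_mul_ofPath, hπ] at hm
    exact ⟨i, j, hij, t.comp s, hm, hw.trans (congrArg _ h1), hd⟩
  · left
    have h := add_mem hcd.comm hd
    rw [sub_add_sub_cancel] at h
    obtain ⟨p, hp, hw, hl⟩ := exists_path_x_pow i m
    refine ⟨i, m, h, ?_, ?_⟩
    · rw [← hw]
      exact pathWt_eq_of_sub_mem_commutators one_le_arrowWeight (hp ▸ h)
    · rw [← hl]
      exact length_eq_of_sub_mem_commutators (hp ▸ h)

theorem target_le_add_degree {v w : QVertex n I} (p : Quiver.Path v w) :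
    w.num.val ≤ v.num.val + qDegree p := by
  induction p with
  | nil => simp
  | cons p a ih =>
    rcases a with ⟨_, _⟩ | ⟨_, _, _⟩ | ⟨_, _, _⟩ <;> simp only [qDegree] <;> omega

theorem target_add_length_of_degree_zero {v w : QVertex n I} (p : Quiver.Path v w)
    (h : qDegree p = 0) : w.num.val + p.length = v.num.val := by
  induction p with
  | nil => simp
  | cons p a ih =>
    rcases a with ⟨_, _⟩ | ⟨_, _, _⟩ | ⟨_, _, _⟩ <;> simp only [qDegree] at h
    · omega
    · omega
    · have := ih h
      rw [Quiver.Path.length_cons]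
      omega

theorem eq_nil_of_degree_zero {v : QVertex n I} (p : Quiver.Path v v) (h : qDegree p = 0) :
    p = Quiver.Path.nil :=
  Quiver.Path.eq_nil_of_length_zero p (by have := target_add_length_of_degree_zero p h; omega)

theorem eq_left_of_degree_zero {v w : QVertex n I} (hvw : v.num.val + 1 = w.num.val)
    (p : Quiver.Path w v) (h : qDegree p = 0) : p = (leftArrow v w hvw).toPath := by
  have hl := target_add_length_of_degree_zero p h
  cases p with
  | nil => omega
  | @cons t _ p a =>
    rw [Quiver.Path.length_cons] at hl
    rcases a with ⟨_, _⟩ | ⟨_, _, _⟩ | ⟨_, _, ht⟩ <;> simp only [qDegree] at h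
    · omega
    · omega
    · obtain rfl : t = w := QVertex.ext_val (by omega)
      rw [eq_nil_of_degree_zero p h]
      rfl

theorem eq_right_of_degree_one {v w : QVertex n I} (hvw : v.num.val + 1 = w.num.val)
    (p : Quiver.Path v w) (h : qDegree p = 1) : p = (rightArrow v w hvw).toPath := by
  cases p with
  | nil => omega
  | @cons t _ p a =>
    rcases a with ⟨_, _⟩ | ⟨_, _, ht⟩ | ⟨_, _, ht⟩ <;> simp only [qDegree] at h
    · have := target_add_length_of_degree_zero p (by omega)
      omega
    · obtain rfl : t = v := QVertex.ext_val (by omega)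
      rw [eq_nil_of_degree_zero p (by omega)]
      rfl
    · have := target_le_add_degree p
      omega

theorem cycle_of_degree_one {v : QVertex n I} (p : Quiver.Path v v) (h : qDegree p = 1) :
    (∃ hv, ofPath ℂ p = (loop v hv : QIndex n I).x) ∨
      (∃ (w : QVertex n I) (hw : v.num.val + 1 = w.num.val),
        ofPath ℂ p = (edge v w hw : QIndex n I).x) ∨
      ∃ (u : QVertex n I) (hu : u.num.val + 1 = v.num.val),
        ofPath ℂ p = (edge u v hu : QIndex n I).x' := by
  cases p with
  | nil => simp [qDegree] at h
  | @cons t _ p a =>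
    rcases a with ⟨_, hv⟩ | ⟨_, _, ht⟩ | ⟨_, _, ht⟩ <;> simp only [qDegree] at h
    · left
      refine ⟨hv, ?_⟩
      rw [eq_nil_of_degree_zero p (by omega), ← ofPath_xPath]
      rfl
    · right; right
      refine ⟨t, ht, ?_⟩
      rw [eq_left_of_degree_zero ht p (by omega), ← ofPath_x'Path]
      rfl
    · right; left
      refine ⟨t, ht, ?_⟩
      rw [eq_right_of_degree_one ht p h, ← ofPath_xPath]
      rfl

/-- The two edges at a vertex that has a loop. -/
inductive QIndex.Skip : QIndex n I → QIndex n I → Prop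
  | mk (u v w : QVertex n I) (h : u.num.val + 1 = v.num.val) (h' : v.num.val + 1 = w.num.val)
    (hv : v.num ∉ I) : Skip (edge u v h) (edge v w h')

theorem QIndex.Skip.tgt_eq_src {i j : QIndex n I} (h : Skip i j) : i.tgt = j.src := by
  cases h
  rfl

theorem xWeight_le (i : QIndex n I) : i.xWeight + 2 ≤ 12 * n := by
  have := i.pos_lt
  rw [xWeight]
  omega

/-- The cycles of degree two, up to rotation. -/
theorem cycle_of_degree_two {u : QVertex n I} (c : Quiver.Path u u) (hc : qDegree c = 2) :
    (∃ i j : QIndex n I, Adj i j ∧ ofPath ℂ c - i.x' * j.x ∈ commutators ℂ (QVertex n I)) ∨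
    (∃ i : QIndex n I, ofPath ℂ c - i.x ^ 2 ∈ commutators ℂ (QVertex n I) ∧
      c.length = 2 * i.xPath.length) ∨
    ∃ i j : QIndex n I, Skip i j ∧ ofPath ℂ c - i.x' * j.x ∈ commutators ℂ (QVertex n I) := by
  have hc0 : c.length ≠ 0 := by
    intro h0
    obtain rfl := Quiver.Path.eq_nil_of_length_zero c h0
    simp [qDegree] at hc
  have hlow := degree_le_wt c
  have hupp := wt_le_degree c
  rw [hc] at hlow hupp
  rcases cycle_reduction c hc0 with ⟨i, m, hm, hw, hl⟩ | ⟨i, j, hij, p, hp, -, hdeg⟩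
  · right; left
    have h1 := xWeight_le i
    have h2 : 8 * n + 2 ≤ i.xWeight := by rw [xWeight]; omega
    -- Degree two confines the weight to the range from 16n + 4 to 24n, whereas one factor x_i
    -- weighs at most 12n - 2 and three weigh at least 24n + 6.
    obtain rfl : m = 1 := by
      rcases m with _ | _ | m
      · rw [zero_add, one_mul] at hw
        omega
      · rfl
      · have : 3 * i.xWeight ≤ (m + 1 + 1 + 1) * i.xWeight := Nat.mul_le_mul_right _ (by omega)
        omega
    exact ⟨i, hm, hl⟩
  · have hdeg1 : qDegree p = 1 := by omega
    have swap : ∀ {k : QIndex n I}, ofPath ℂ p * (j.b * i.x') = k.x * i.x' →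
        ofPath ℂ c - i.x' * k.x ∈ commutators ℂ (QVertex n I) := by
      intro k hk
      rw [hk] at hp
      have := add_mem hp (mul_sub_mul_mem_commutators k.x i.x')
      rwa [sub_add_sub_cancel] at this
    cases hij with
    | loopEdge v w hv h =>
      refine Or.inl ⟨_, _, Adj.loopEdge v w hv h, swap ?_⟩
      rw [eq_right_of_degree_one h p hdeg1, ← mul_assoc]
      rfl
    | edgeEdge u v w h h' hv =>
      refine Or.inl ⟨_, _, Adj.edgeEdge u v w h h' hv, swap ?_⟩
      rw [eq_right_of_degree_one h' p hdeg1, ← mul_assoc]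
      rfl
    | edgeLoop u v h hv =>
      have hb : (loop v hv).b * (edge u v h).x' = (edge u v h).x' := by
        rw [← ofPath_x'Path]
        exact idem_mul_ofPath _
      -- Here b_j is lazy, so `p` is a cycle of degree one at `v`: the loop gives an adjacent pair,
      -- the edge to the right a skip term, and the edge to the left x_i' squared, a rotation of x_i
      -- squared.
      rcases cycle_of_degree_one (v := v) p hdeg1 with ⟨hv', e⟩ | ⟨w, h', e⟩ | ⟨u', h', e⟩
      · refine Or.inl ⟨_, _, Adj.edgeLoop u v h hv, swap ?_⟩
        rw [hb]
        exact congrArg (· * _) e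
      · refine Or.inr (Or.inr ⟨_, _, Skip.mk u v w h h' hv, swap ?_⟩)
        rw [hb]
        exact congrArg (· * _) e
      · obtain rfl : u' = u := QVertex.ext_val (by omega)
        rw [hb, show ofPath ℂ p = (edge u' v h').x' from e] at hp
        refine Or.inr (Or.inl ⟨edge u' v h, ?_, ?_⟩)
        · have := add_mem hp
            (mul_sub_mul_mem_commutators ((edge u' v h).b * (edge u' v h).a * (edge u' v h).b)
              (edge u' v h).a)
          have e2 : (edge u' v h).x ^ 2 = (edge u' v h).a *
              ((edge u' v h).b * (edge u' v h).a * (edge u' v h).b) := by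
            rw [sq, x]
            noncomm_ring
          rw [e2]
          refine (congrArg (· ∈ commutators ℂ (QVertex n I)) ?_).mp this
          rw [x']
          noncomm_ring
        · have h3 : ofPath ℂ c - ofPath ℂ ((edge u' v h : QIndex n I).x'Path.comp
              (edge u' v h : QIndex n I).x'Path) ∈ commutators ℂ (QVertex n I) := by
            rwa [← ofPath_mul_ofPath, ofPath_x'Path]
          rw [length_eq_of_sub_mem_commutators h3]
          rfl

/-- The sum of the two positions is 4v + 1 for the loop at v and the next edge, 4v - 1 for an edge
and the loop at its right end v, and 4v for the two edges at v. These values are all distinct. -/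
theorem QIndex.Adj.eq_of_xWeight_add {i j i' j' : QIndex n I} (h : Adj i j) (h' : Adj i' j')
    (hw : i.xWeight + j.xWeight = i'.xWeight + j'.xWeight) : i = i' ∧ j = j' := by
  suffices e : i.pos = i'.pos by
    obtain rfl := pos_injective e
    exact ⟨rfl, h.right_unique h'⟩
  cases h <;> cases h' <;> simp only [xWeight, pos] at hw ⊢ <;> omega

/-- Twice a position is 4v or 4v + 2. The only possible coincidence is between two adjacent edges at
v and the square of the loop at v, but such edges are adjacent only if that loop is missing. Skip
terms are separated for the same reason in `Adj.xWeight_add_ne_skip`. -/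
theorem QIndex.Adj.xWeight_add_ne_two_mul {i j : QIndex n I} (h : Adj i j) (l : QIndex n I) :
    i.xWeight + j.xWeight ≠ 2 * l.xWeight := by
  intro hw
  cases h with
  | loopEdge v w hv h => cases l <;> simp only [xWeight, pos] at hw <;> omega
  | edgeLoop v w h hv => cases l <;> simp only [xWeight, pos] at hw <;> omega
  | edgeEdge u v w h h' hv =>
    cases l with
    | loop v' hv' =>
      simp only [xWeight, pos] at hw
      obtain rfl : v' = v := QVertex.ext_val (by omega)
      exact hv' hv
    | edge => simp only [xWeight, pos] at hw; omega

theorem QIndex.Adj.xWeight_add_ne_skip {i j i' j' : QIndex n I} (h : Adj i j) (h' : Skip i' j') :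
    i.xWeight + j.xWeight ≠ i'.xWeight + j'.xWeight := by
  intro hw
  obtain ⟨u', v', w', hu', hw', hv'⟩ := h'
  cases h with
  | loopEdge v w hv h => simp only [xWeight, pos] at hw; omega
  | edgeLoop v w h hv => simp only [xWeight, pos] at hw; omega
  | edgeEdge u v w h h' hv =>
    simp only [xWeight, pos] at hw
    obtain rfl : v' = v := QVertex.ext_val (by omega)
    exact hv' hv

end Reduction

/-! ### Elementary automorphisms, and elimination in degree at least three. -/

section Elementary

variable {n : ℕ} {I : Finset (Fin n)}

namespace QIndex

theorem wt_aPath_add_wt_bPath (j : QIndex n I) : wt j.aPath + wt j.bPath = j.xWeight := by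
  rw [← wt_xPath, wt, wt, wt, xPath, pathWt_comp]

theorem Adj.xWeight_lt {i j : QIndex n I} (h : Adj i j) : i.xWeight < j.xWeight := by
  have := h.pos_lt_pos
  rw [xWeight, xWeight]
  omega

theorem x_mem_wtPow (i : QIndex n I) : i.x ∈ wtPow ℂ arrowWeight i.xWeight := by
  rw [← ofPath_xPath, ← wt_xPath]
  exact ofPath_mem_wtPow _

theorem b_mem_wtPow (i : QIndex n I) : i.b ∈ wtPow ℂ arrowWeight (wt i.bPath) := by
  rw [← ofPath_bPath]
  exact ofPath_mem_wtPow _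

theorem eq_of_src_tgt {l j : QIndex n I} (hs : l.src = j.src) (ht : l.tgt = j.tgt) : l = j := by
  cases l <;> cases j <;> simp only [src, tgt] at hs ht <;> subst hs
  · rfl
  · subst ht
    omega
  · subst ht
    omega
  · subst ht
    rfl

end QIndex

theorem sigma_eq_of_ofPath_eq {V : Type*} [Quiver V] {u v u' v' : V} {p : Quiver.Path u v}
    {q : Quiver.Path u' v'} (h : ofPath ℂ p = ofPath ℂ q) :
    (⟨u, v, p⟩ : Σ i j : V, Quiver.Path i j) = ⟨u', v', q⟩ := by
  by_contra hne
  have h1 : ofPath ℂ p u v p = ofPath ℂ q u v p := by rw [h]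
  rw [ofPath_self, ofPath_of_ne _ _ hne] at h1
  exact one_ne_zero h1

theorem QIndex.sigma_eq_of_ofArrow_eq {j : QIndex n I} {v w : QVertex n I} {a : v ⟶ w}
    (h : ofArrow ℂ a = j.a) :
    v = j.src ∧ w = j.tgt ∧ arrowWeight v w a = wt j.aPath := by
  rw [← ofPath_aPath] at h
  have e := sigma_eq_of_ofPath_eq h
  refine ⟨congrArg (fun P => P.1) e, congrArg (fun P => P.2.1) e, ?_⟩
  have := congrArg (fun P : (Σ i j : QVertex n I, Quiver.Path i j) => wt P.2.2) e
  exact (pathWt_toPath _ _).symm.trans this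

open Classical in
/-- The automorphism `a_j ↦ a_j + y`. -/
theorem exists_elementary (j : QIndex n I) (δ : ℕ) (y : CompletePathAlgebra ℂ (QVertex n I))
    (hl : idem ℂ j.src * y = y) (hr : y * idem ℂ j.tgt = y)
    (hy : y ∈ wtPow ℂ arrowWeight (wt j.aPath + δ)) :
    ∃ ρ : CompletePathAlgebra ℂ (QVertex n I) →ₐ[ℂ] CompletePathAlgebra ℂ (QVertex n I),
      RaisesBy arrowWeight δ ρ ∧ ρ j.a = j.a + y ∧ (∀ l, l ≠ j → ρ l.a = l.a) ∧
        ∀ l : QIndex n I, ρ l.b = l.b := by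
  -- Arrows are compared as elements of the algebra, since their endpoints vary.
  let φ : ∀ v w : QVertex n I, (v ⟶ w) → CompletePathAlgebra ℂ (QVertex n I) :=
    fun v w a => ofArrow ℂ a + if ofArrow ℂ a = j.a then y else 0
  have harrow : ∀ (v w : QVertex n I) (a : v ⟶ w),
      ofArrow ℂ a ∈ wtPow ℂ arrowWeight (arrowWeight v w a) := by
    intro v w a
    have := ofPath_mem_wtPow (k := ℂ) (ω := arrowWeight) a.toPath
    rwa [pathWt_toPath] at this
  have hφ : IsSubst arrowWeight φ := by
    refine ⟨fun v w a => ?_, fun v w a => ?_, fun v w a => ?_⟩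
    · change idem ℂ v * (ofArrow ℂ a + ite _ _ _) = ofArrow ℂ a + ite _ _ _
      rw [mul_add, ofArrow, idem_mul_ofPath]
      split_ifs with h
      · refine congrArg (ofPath ℂ a.toPath + ·) ?_
        rw [(sigma_eq_of_ofArrow_eq h).1, hl]
      · rw [mul_zero]
    · change (ofArrow ℂ a + ite _ _ _) * idem ℂ w = ofArrow ℂ a + ite _ _ _
      rw [add_mul, ofArrow, ofPath_mul_idem]
      split_ifs with h
      · refine congrArg (ofPath ℂ a.toPath + ·) ?_
        rw [(sigma_eq_of_ofArrow_eq h).2.1, hr]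
      · rw [zero_mul]
    · refine add_mem (harrow v w a) ?_
      split_ifs with h
      · rw [(sigma_eq_of_ofArrow_eq h).2.2]
        exact wtPow_mono (Nat.le_add_right _ _) hy
      · exact zero_mem _
  refine ⟨hφ.hom one_le_arrowWeight, hφ.raisesBy one_le_arrowWeight fun v w a => ?_, ?_,
    fun l hne => ?_, fun l => ?_⟩
  · change ofArrow ℂ a + ite _ _ _ - ofArrow ℂ a ∈ _
    rw [add_sub_cancel_left]
    split_ifs with h
    · rw [(sigma_eq_of_ofArrow_eq h).2.2]
      exact hy
    · exact zero_mem _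
  · cases j with
    | loop v hv => exact (hφ.hom_ofArrow _ _).trans (congrArg ((loop v hv).a + ·) (if_pos rfl))
    | edge v w h => exact (hφ.hom_ofArrow _ _).trans (congrArg ((edge v w h).a + ·) (if_pos rfl))
  · have hla : l.a ≠ j.a := by
      intro h
      rw [← ofPath_aPath, ← ofPath_aPath] at h
      have e := sigma_eq_of_ofPath_eq h
      exact hne (eq_of_src_tgt (congrArg (fun P => P.1) e) (congrArg (fun P => P.2.1) e))
    cases l with
    | loop v hv =>
      exact (hφ.hom_ofArrow _ _).trans ((congrArg _ (if_neg hla)).trans (add_zero _))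
    | edge v w h =>
      exact (hφ.hom_ofArrow _ _).trans ((congrArg _ (if_neg hla)).trans (add_zero _))
  · cases l with
    | loop v hv => exact hφ.hom_idem _ v
    | edge v w h =>
      refine (hφ.hom_ofArrow _ _).trans ((congrArg _ (if_neg fun e => ?_)).trans (add_zero _))
      obtain ⟨h1, h2, -⟩ := sigma_eq_of_ofArrow_eq e
      cases j with
      | loop v' hv' =>
        simp only [src, tgt] at h1 h2
        subst h1
        subst h2
        omega
      | edge v' w' h' =>
        simp only [src, tgt] at h1 h2
        subst h1
        subst h2
        omega

open Classical in
/-- The sum of all `x_i' x_{i+1}`. -/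
noncomputable def leading (n : ℕ) (I : Finset (Fin n)) : CompletePathAlgebra ℂ (QVertex n I) :=
  ∑ i : QIndex n I, ∑ j : QIndex n I, if i.IsNext j then i.x' * j.x else 0

/-- The sum of all `κ_{ij} x_i ^ j`. -/
noncomputable def powerPart (κ : QIndex n I → ℕ → ℂ) : CompletePathAlgebra ℂ (QVertex n I) :=
  ∑ i : QIndex n I, seriesFromTwo (κ i) i.x

theorem monomialPotential_eq (κ : QIndex n I → ℕ → ℂ) :
    monomialPotential κ = leading n I + powerPart κ := rfl

section

variable {j : QIndex n I} {y : CompletePathAlgebra ℂ (QVertex n I)}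
  {ρ : CompletePathAlgebra ℂ (QVertex n I) →ₐ[ℂ] CompletePathAlgebra ℂ (QVertex n I)}

theorem elementary_x (hne : ∀ l, l ≠ j → ρ l.a = l.a) (hb : ∀ l : QIndex n I, ρ l.b = l.b)
    {l : QIndex n I} (h : l ≠ j) : ρ l.x = l.x := by
  rw [x, map_mul, hne l h, hb]

theorem elementary_x' (hne : ∀ l, l ≠ j → ρ l.a = l.a) (hb : ∀ l : QIndex n I, ρ l.b = l.b)
    {l : QIndex n I} (h : l ≠ j) : ρ l.x' = l.x' := by
  rw [x', map_mul, hne l h, hb]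

-- The arrow a_j enters only the two summands x_i' x_j and x_j' x_l, and each of them linearly, so
-- no term quadratic in `y` arises.
open Classical in
theorem elementary_leading (hj : ρ j.a = j.a + y) (hne : ∀ l, l ≠ j → ρ l.a = l.a)
    (hb : ∀ l : QIndex n I, ρ l.b = l.b) {i : QIndex n I} (hij : Adj i j) :
    ρ (leading n I) = leading n I + i.x' * (y * j.b) +
      ∑ l : QIndex n I, if j.IsNext l then (j.b * y) * l.x else 0 := by
  have hx : ρ j.x = j.x + y * j.b := by rw [x, map_mul, hj, hb, add_mul]
  have hx' : ρ j.x' = j.x' + j.b * y := by rw [x', map_mul, hj, hb, mul_add]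
  have term : ∀ k l : QIndex n I, ρ (if k.IsNext l then k.x' * l.x else 0) =
      (if k.IsNext l then k.x' * l.x else 0) +
        (if l = j then (if k.IsNext j then k.x' * (y * j.b) else 0) else 0) +
        (if k = j then (if j.IsNext l then (j.b * y) * l.x else 0) else 0) := by
    intro k l
    by_cases hkl : k.IsNext l
    · by_cases hk : k = j
      · subst hk
        have hl : l ≠ k := by
          rintro rfl
          exact lt_irrefl _ hkl.1
        rw [if_pos hkl, if_pos hkl, if_neg hl, if_pos rfl, map_mul, hx', elementary_x hne hb hl,
          add_mul, add_zero]
      · by_cases hl : l = j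
        · subst hl
          rw [if_pos hkl, if_pos hkl, if_pos rfl, if_neg hk, map_mul, hx,
            elementary_x' hne hb hk, mul_add, add_zero]
        · rw [if_pos hkl, if_neg hl, if_neg hk, map_mul, elementary_x hne hb hl,
            elementary_x' hne hb hk, add_zero, add_zero]
    · rw [if_neg hkl, map_zero, zero_add]
      by_cases hk : k = j
      · subst hk
        rw [if_neg hkl, if_pos rfl, add_zero]
        by_cases hl : l = k
        · subst hl
          rw [if_neg hkl, if_pos rfl]
        · rw [if_neg hl]
      · rw [if_neg hk, add_zero]
        by_cases hl : l = j
        · subst hl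
          rw [if_neg hkl, if_pos rfl]
        · rw [if_neg hl]
  have first : ∑ k : QIndex n I, ∑ l : QIndex n I,
      (if l = j then (if k.IsNext j then k.x' * (y * j.b) else 0) else 0) = i.x' * (y * j.b) := by
    simp only [Finset.sum_ite_eq', Finset.mem_univ, if_true]
    rw [Finset.sum_eq_single i, if_pos (isNext_iff_adj.2 hij)]
    · intro k _ hk
      exact if_neg fun h => hk ((isNext_iff_adj.1 h).left_unique hij)
    · exact fun h => absurd (Finset.mem_univ i) h
  have second : ∑ k : QIndex n I, ∑ l : QIndex n I,
      (if k = j then (if j.IsNext l then (j.b * y) * l.x else 0) else 0) =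
        ∑ l : QIndex n I, if j.IsNext l then (j.b * y) * l.x else 0 := by
    rw [Finset.sum_comm]
    simp only [Finset.sum_ite_eq', Finset.mem_univ, if_true]
  rw [leading]
  simp only [map_sum, term, Finset.sum_add_distrib]
  rw [first, second]

end

/-- Powers x ^ d with d above the length of `p` do not see `p`; hence one upper bound can serve
several paths or series. -/
theorem seriesFromTwo_coeff (κ : ℕ → ℂ) (i : QIndex n I) {u v : QVertex n I}
    (p : Quiver.Path u v) {N : ℕ} (hN : p.length ≤ N) :
    seriesFromTwo κ i.x u v p = ∑ d ∈ Finset.Icc 2 N, κ d * (i.x ^ d) u v p := by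
  refine Finset.sum_subset (Finset.Icc_subset_Icc le_rfl hN) fun d hd hd' => ?_
  have hlen : 1 ≤ i.xPath.length := by
    rw [xPath, Quiver.Path.length_comp]
    cases i <;> exact Nat.le_add_right 1 _
  have hx : i.x ∈ wtPow ℂ (fun _ _ _ => 1) 1 := by
    rw [← ofPath_xPath]
    refine wtPow_mono ?_ (ofPath_mem_wtPow _)
    rwa [pathWt_one]
  have hlt : p.length < d * 1 := by
    rw [Finset.mem_Icc] at hd hd'
    omega
  rw [pow_mem_wtPow hx d u v p (by rwa [pathWt_one]), mul_zero]

theorem powerPart_sub_mem (κ : QIndex n I → ℕ → ℂ) (N : ℕ) :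
    powerPart κ - ∑ i : QIndex n I, ∑ d ∈ Finset.Icc 2 N, κ i d • i.x ^ d ∈
      wtPow ℂ arrowWeight (N + 1) := by
  rw [powerPart, ← Finset.sum_sub_distrib]
  refine Submodule.sum_mem _ fun i _ u v p hp => ?_
  have hlen := length_le_pathWt one_le_arrowWeight p
  rw [sub_coeff, seriesFromTwo_coeff (κ i) i p (N := N) (by omega), sum_coeff, sub_eq_zero]
  rfl

theorem powerPart_sub_powerPart_mem {κ κ' : QIndex n I → ℕ → ℂ} {W : ℕ}
    (h : ∀ i d, d * i.xWeight < W → κ i d = κ' i d) :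
    powerPart κ - powerPart κ' ∈ wtPow ℂ arrowWeight W := by
  rw [powerPart, powerPart, ← Finset.sum_sub_distrib]
  refine Submodule.sum_mem _ fun i _ u v p hp => ?_
  rw [sub_coeff, seriesFromTwo_coeff _ i p le_rfl, seriesFromTwo_coeff _ i p le_rfl, sub_eq_zero]
  refine Finset.sum_congr rfl fun d _ => ?_
  by_cases hd : d * i.xWeight < W
  · rw [h i d hd]
  · rw [pow_mem_wtPow i.x_mem_wtPow d u v p (by omega), mul_zero, mul_zero]

open Classical in
theorem powerPart_update (κ : QIndex n I → ℕ → ℂ) (i : QIndex n I) {d : ℕ} (hd : 2 ≤ d) (c : ℂ) :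
    powerPart (fun l m => κ l m + if l = i ∧ m = d then c else 0) =
      powerPart κ + c • i.x ^ d := by
  have key : ∀ l : QIndex n I, seriesFromTwo (fun m => κ l m + if l = i ∧ m = d then c else 0) l.x =
      seriesFromTwo (κ l) l.x + if l = i then c • i.x ^ d else 0 := by
    intro l
    ext u v p
    rw [add_coeff, seriesFromTwo_coeff _ l p (Nat.le_add_right _ d),
      seriesFromTwo_coeff _ l p (Nat.le_add_right _ d)]
    simp only [add_mul, Finset.sum_add_distrib]
    congr 1
    by_cases hl : l = i
    · subst hl
      rw [if_pos rfl, smul_coeff, Finset.sum_eq_single d]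
      · rw [if_pos ⟨rfl, rfl⟩]
      · intro m _ hm
        rw [if_neg (fun h => hm h.2), zero_mul]
      · intro h
        exact absurd (Finset.mem_Icc.2 ⟨hd, by omega⟩) h
    · rw [if_neg hl, zero_coeff]
      refine Finset.sum_eq_zero fun m _ => ?_
      rw [if_neg (fun h => hl h.1), zero_mul]
  rw [powerPart, powerPart]
  simp only [key, Finset.sum_add_distrib, Finset.sum_ite_eq', Finset.mem_univ, if_true]

/-- Only powers of x_j move. The lightest one is the square, so every change has weight at least 2
`j.xWeight` + `δ`, which exceeds `W`. -/
theorem raisesBy_powerPart {δ W : ℕ} {j : QIndex n I}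
    {ρ : CompletePathAlgebra ℂ (QVertex n I) →ₐ[ℂ] CompletePathAlgebra ℂ (QVertex n I)}
    (hρ : RaisesBy arrowWeight δ ρ) (hx : ∀ l, l ≠ j → ρ l.x = l.x)
    (hW : W < 2 * j.xWeight + δ) (κ : QIndex n I → ℕ → ℂ) :
    ρ (powerPart κ) - powerPart κ ∈ wtPow ℂ arrowWeight (W + 1) := by
  have hr := powerPart_sub_mem κ W
  set S := ∑ i : QIndex n I, ∑ d ∈ Finset.Icc 2 W, κ i d • i.x ^ d with hS
  have hSmem : ρ S - S ∈ wtPow ℂ arrowWeight (W + 1) := by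
    rw [hS, map_sum, ← Finset.sum_sub_distrib]
    refine Submodule.sum_mem _ fun i _ => ?_
    rw [map_sum, ← Finset.sum_sub_distrib]
    refine Submodule.sum_mem _ fun d hd => ?_
    rw [map_smul, ← smul_sub]
    refine Submodule.smul_mem _ _ ?_
    by_cases hi : i = j
    · subst hi
      refine wtPow_mono ?_ (hρ.raise _ _ (pow_mem_wtPow i.x_mem_wtPow d))
      have : 2 * i.xWeight ≤ d * i.xWeight := Nat.mul_le_mul_right _ (Finset.mem_Icc.1 hd).1
      omega
    · rw [map_pow, hx i hi, sub_self]
      exact zero_mem _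
  have h2 := add_mem (sub_mem (hρ.mem hr) hr) hSmem
  rw [map_sub] at h2
  refine (congrArg (· ∈ wtPow ℂ arrowWeight (W + 1)) ?_).mp h2
  abel

/-- `y` can be removed by an automorphism that changes no terms of smaller weight. -/
def Removable (W : ℕ) (y : CompletePathAlgebra ℂ (QVertex n I)) : Prop :=
  ∀ κ : QIndex n I → ℕ → ℂ,
    ∃ (ρ : CompletePathAlgebra ℂ (QVertex n I) →ₐ[ℂ] CompletePathAlgebra ℂ (QVertex n I))
      (κ' : QIndex n I → ℕ → ℂ), RaisesBy arrowWeight (W + 1 - (24 * n + 6)) ρ ∧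
      (∀ i d, d * i.xWeight ≠ W → κ' i d = κ i d) ∧
      ∀ e ∈ wtPow ℂ arrowWeight W, ρ (monomialPotential κ + y + e) - (monomialPotential κ' + e) ∈
        cycPow ℂ arrowWeight (W + 1)

theorem removable_of_mem {W : ℕ} {y : CompletePathAlgebra ℂ (QVertex n I)}
    (hy : y ∈ cycPow ℂ arrowWeight (W + 1)) : Removable W y := by
  refine fun κ => ⟨AlgHom.id ℂ _, κ, RaisesBy.id _, fun _ _ _ => rfl, fun e _ => ?_⟩
  rw [AlgHom.id_apply, add_right_comm, add_sub_cancel_left]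
  exact hy

/-- This is why `Removable` quantifies over `κ` and `e`: while `y` is being removed, `y'` travels
along inside the spectator `e`, and its own removal then starts from the new coefficients. -/
theorem Removable.add {W : ℕ} {y y' : CompletePathAlgebra ℂ (QVertex n I)} (h : Removable W y)
    (h' : Removable W y') (hy' : y' ∈ wtPow ℂ arrowWeight W) : Removable W (y + y') := by
  intro κ
  obtain ⟨ρ₁, κ₁, hρ₁, hκ₁, h₁⟩ := h κ
  obtain ⟨ρ₂, κ₂, hρ₂, hκ₂, h₂⟩ := h' κ₁
  refine ⟨ρ₂.comp ρ₁, κ₂, hρ₂.comp hρ₁, fun i d hd => (hκ₂ i d hd).trans (hκ₁ i d hd),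
    fun e he => ?_⟩
  have := add_mem (map_mem_cycPow ρ₂ (fun f hf => hρ₂.mem hf) (h₁ (y' + e) (add_mem hy' he)))
    (h₂ e he)
  rw [map_sub, AlgHom.comp_apply] at *
  rw [← add_assoc (monomialPotential κ₁), sub_add_sub_cancel, ← add_assoc] at this
  rwa [← add_assoc (monomialPotential κ)]

/-- The core of the elimination. A power of x_i is absorbed into the coefficients. Otherwise `c` is
a rotation of p b_j x_i', and a_j ↦ a_j - r p cancels it against x_i' x_j. The side effects are
heavier because x_i is lighter than x_j, which is lighter than x_l. -/
theorem removable_ofPath {u v : QVertex n I} (c : Quiver.Path u v) (hc : 24 * n + 6 ≤ wt c)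
    (r : ℂ) : Removable (wt c) (r • ofPath ℂ c) := by
  classical
  by_cases huv : u = v
  swap
  · exact removable_of_mem (Submodule.smul_mem _ _
      (commutators_le_cycPow _ (ofPath_mem_commutators_of_ne c huv)))
  subst huv
  have hc0 : c.length ≠ 0 := by
    intro h0
    obtain rfl := Quiver.Path.eq_nil_of_length_zero c h0
    rw [wt, pathWt_nil] at hc
    omega
  intro κ
  rcases cycle_reduction c hc0 with ⟨i, m, hm, hw, -⟩ | ⟨i, j, hij, p, hp, hw, -⟩
  · have hm1 : 2 ≤ m + 1 := by
      by_contra hlt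
      obtain rfl : m = 0 := by omega
      have := xWeight_le i
      omega
    refine ⟨AlgHom.id ℂ _, fun l d => κ l d + if l = i ∧ d = m + 1 then r else 0, RaisesBy.id _,
      fun l d hd => ?_, fun e _ => ?_⟩
    · dsimp only
      rw [if_neg, add_zero]
      rintro ⟨rfl, rfl⟩
      exact hd hw.symm
    · rw [AlgHom.id_apply, monomialPotential_eq, monomialPotential_eq, powerPart_update κ i hm1]
      have := commutators_le_cycPow (ω := arrowWeight) (wt c + 1) (Submodule.smul_mem _ r hm)
      refine (congrArg (· ∈ cycPow ℂ arrowWeight (wt c + 1)) ?_).mp this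
      rw [smul_sub]
      abel
  · have hwi := xWeight_le i
    have hwj := xWeight_le j
    have hab := wt_aPath_add_wt_bPath j
    have hlt := hij.xWeight_lt
    -- The gain `δ` is `wt c` minus the weights of x_i and x_j. It is positive, as these weights add
    -- up to at most 24n - 4.
    obtain ⟨δ, hδ⟩ := Nat.exists_eq_add_of_le (show wt j.aPath ≤ wt p by omega)
    have hpmem : ofPath ℂ p ∈ wtPow ℂ arrowWeight (wt p) := ofPath_mem_wtPow p
    obtain ⟨ρ, hρ, hja, hne, hb⟩ := exists_elementary j δ ((-r) • ofPath ℂ p)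
      (by rw [mul_smul_comm, ← hij.tgt_eq_src, idem_mul_ofPath])
      (by rw [smul_mul_assoc, ofPath_mul_idem])
      (by rw [← hδ]; exact Submodule.smul_mem _ _ hpmem)
    refine ⟨ρ, κ, hρ.mono (by omega), fun _ _ _ => rfl, fun e he => ?_⟩
    -- The bound needed is `wt c` < 2 `j.xWeight` + `δ`; its right side is `wt c` + `j.xWeight` -
    -- `i.xWeight`.
    have h1 : ρ (powerPart κ) - powerPart κ ∈ cycPow ℂ arrowWeight (wt c + 1) :=
      wtPow_le_cycPow _ (raisesBy_powerPart (W := wt c) hρ (fun l hl => elementary_x hne hb hl)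
        (by omega) κ)
    have h2 : ρ (r • ofPath ℂ c + e) - (r • ofPath ℂ c + e) ∈ cycPow ℂ arrowWeight (wt c + 1) :=
      wtPow_le_cycPow _ (wtPow_mono (by omega)
        (hρ.raise (wt c) _ (add_mem (Submodule.smul_mem _ r (ofPath_mem_wtPow c)) he)))
    -- The new term b_j p x_l arises from `c`, up to rotation, by exchanging x_i' for the heavier
    -- x_l.
    have h3 : ∑ l : QIndex n I,
        (if j.IsNext l then (j.b * ((-r) • ofPath ℂ p)) * l.x else 0) ∈
          cycPow ℂ arrowWeight (wt c + 1) := by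
      refine wtPow_le_cycPow _ (Submodule.sum_mem _ fun l _ => ?_)
      split_ifs with hl
      · have hjl := (isNext_iff_adj.1 hl).xWeight_lt
        exact wtPow_mono (by omega) (mul_mem_wtPow (mul_mem_wtPow j.b_mem_wtPow
          (Submodule.smul_mem _ (-r) hpmem)) l.x_mem_wtPow)
      · exact zero_mem _
    have h4 : i.x' * ((-r) • ofPath ℂ p * j.b) + r • ofPath ℂ c ∈
        cycPow ℂ arrowWeight (wt c + 1) := by
      refine commutators_le_cycPow _ ?_
      have := add_mem (mul_sub_mul_mem_commutators i.x' ((-r) • ofPath ℂ p * j.b))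
        (Submodule.smul_mem _ r hp)
      refine (congrArg (· ∈ commutators ℂ (QVertex n I)) ?_).mp this
      rw [smul_sub, neg_smul, mul_assoc, neg_mul, neg_mul, smul_mul_assoc, smul_mul_assoc]
      abel
    have := add_mem (add_mem h1 h2) (add_mem h3 h4)
    refine (congrArg (· ∈ cycPow ℂ arrowWeight (wt c + 1)) ?_).mp this
    rw [monomialPotential_eq, add_assoc _ (r • ofPath ℂ c),
      map_add ρ (leading n I + powerPart κ), map_add ρ (leading n I),
      elementary_leading hja hne hb hij]
    abel

theorem removable_of_mem_wtPow {W : ℕ} (hW : 24 * n + 6 ≤ W)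
    {y : CompletePathAlgebra ℂ (QVertex n I)} (hy : y ∈ wtPow ℂ arrowWeight W) :
    Removable W y := by
  classical
  have term : ∀ P : (Σ i j : QVertex n I, Quiver.Path i j), wt P.2.2 < W + 1 →
      Removable W (y P.1 P.2.1 P.2.2 • ofPath ℂ P.2.2) ∧
        y P.1 P.2.1 P.2.2 • ofPath ℂ P.2.2 ∈ wtPow ℂ arrowWeight W := by
    intro P hP
    by_cases hlt : wt P.2.2 < W
    · rw [hy _ _ _ hlt, zero_smul]
      exact ⟨removable_of_mem (zero_mem _), zero_mem _⟩
    · obtain rfl : wt P.2.2 = W := by omega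
      exact ⟨removable_ofPath _ hW _, Submodule.smul_mem _ _ (ofPath_mem_wtPow _)⟩
  have sums : ∀ S : Finset (Σ i j : QVertex n I, Quiver.Path i j),
      (∀ P ∈ S, wt P.2.2 < W + 1) →
        Removable W (∑ P ∈ S, y P.1 P.2.1 P.2.2 • ofPath ℂ P.2.2) := by
    intro S
    induction S using Finset.induction_on with
    | empty => exact fun _ => removable_of_mem (zero_mem _)
    | insert P S hPS ih =>
      intro h
      rw [Finset.sum_insert hPS]
      refine (term P (h P (Finset.mem_insert_self _ _))).1.add
        (ih fun Q hQ => h Q (Finset.mem_insert_of_mem hQ)) ?_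
      exact Submodule.sum_mem _ fun Q hQ => (term Q (h Q (Finset.mem_insert_of_mem hQ))).2
  have hr := sub_trunc_mem one_le_arrowWeight (W + 1) y
  rw [← add_sub_cancel (trunc one_le_arrowWeight (W + 1) y) y]
  exact (sums _ fun P hP => (mem_pathsBelow one_le_arrowWeight).1 hP).add
    (removable_of_mem (wtPow_le_cycPow _ hr)) (wtPow_mono (Nat.le_succ _) hr)

/-- A potential that is monomialized up to terms of degree at least three can be monomialized. -/
theorem exists_monomialization (f : CompletePathAlgebra ℂ (QVertex n I))
    (κ₀ : QIndex n I → ℕ → ℂ)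
    (h₀ : f - monomialPotential κ₀ ∈ cycPow ℂ arrowWeight (24 * n + 6)) :
    ∃ (ρ : CompletePathAlgebra ℂ (QVertex n I) →ₐ[ℂ] CompletePathAlgebra ℂ (QVertex n I))
      (κ : QIndex n I → ℕ → ℂ), RaisesBy arrowWeight 1 ρ ∧ CycEquiv (ρ f) (monomialPotential κ) ∧
        ∀ i d, d * i.xWeight < 24 * n + 6 → κ i d = κ₀ i d := by
  let A := CompletePathAlgebra ℂ (QVertex n I)
  let Inv : ℕ → (A →ₐ[ℂ] A) × (QIndex n I → ℕ → ℂ) → Prop := fun m s =>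
    RaisesBy arrowWeight 1 s.1 ∧
      s.1 f - monomialPotential s.2 ∈ cycPow ℂ arrowWeight (24 * n + 6 + m)
  have next : ∀ m s, Inv m s → ∃ s', Inv (m + 1) s' ∧
      (∀ g : A, s'.1 g - s.1 g ∈ wtPow ℂ arrowWeight m) ∧
      ∀ i d, d * i.xWeight ≠ 24 * n + 6 + m → s'.2 i d = s.2 i d := by
    rintro m ⟨Φ, κ⟩ ⟨hΦ, hf⟩
    obtain ⟨c, hc, e, he, hce⟩ := Submodule.mem_sup.1 hf
    obtain ⟨ρ, κ', hρ, hκ, h⟩ := removable_of_mem_wtPow (by omega) he κ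
    -- The gain grows with the stage `m`; this makes the infinite composite converge.
    have hρ' : RaisesBy arrowWeight (m + 1) ρ := hρ.mono (by omega)
    refine ⟨⟨ρ.comp Φ, κ'⟩, ⟨(hρ'.mono (by omega)).comp hΦ, ?_⟩, fun g => ?_, hκ⟩
    · have h1 := add_mem (h 0 (zero_mem _)) (commutators_le_cycPow (ω := arrowWeight)
        (24 * n + 6 + m + 1) (map_mem_commutators ρ hc))
      refine (congrArg (· ∈ cycPow ℂ arrowWeight (24 * n + 6 + (m + 1))) ?_).mp h1
      have e1 : Φ f = monomialPotential κ + e + c := by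
        rw [sub_eq_iff_eq_add.1 hce.symm]
        abel
      rw [AlgHom.comp_apply, e1, map_add ρ _ c, add_zero, add_zero]
      abel
    · have := hρ'.raise 0 (Φ g) (mem_wtPow_zero _)
      exact wtPow_mono (by omega) this
  choose! N hN using next
  let s : ℕ → (A →ₐ[ℂ] A) × (QIndex n I → ℕ → ℂ) :=
    fun m => Nat.rec (AlgHom.id ℂ A, κ₀) (fun m s => N m s) m
  have hs : ∀ m, Inv m (s m) := by
    intro m
    induction m with
    | zero => exact ⟨RaisesBy.id 1, h₀⟩
    | succ m ih => exact (hN m _ ih).1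
  obtain ⟨Ψ, hΨ, hlim⟩ := RaisesBy.exists_limit (ω := arrowWeight) (fun m => (s m).1)
    (fun m => (hs m).1) (fun m g => (hN m _ (hs m)).2.1 g)
  have stable : ∀ i d m l, d * i.xWeight < 24 * n + 6 + m → (s (m + l)).2 i d = (s m).2 i d := by
    intro i d m l hd
    induction l with
    | zero => rfl
    | succ l ih => exact ((hN (m + l) _ (hs (m + l))).2.2 i d (by omega)).trans ih
  -- The coefficient of x_i ^ d can change only at the stage treating weight `d * i.xWeight`, so by
  -- stage number `d * i.xWeight` it is final.
  let κ : QIndex n I → ℕ → ℂ := fun i d => (s (d * i.xWeight)).2 i d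
  have hκ : ∀ i d m, d * i.xWeight < 24 * n + 6 + m → κ i d = (s m).2 i d := by
    intro i d m hd
    rw [← stable i d m (d * i.xWeight) hd, add_comm m]
    exact (stable i d _ m (by omega)).symm
  refine ⟨Ψ, κ, hΨ, CycEquiv.of_mem_cycPow arrowWeight_le fun m => ?_, fun i d hd => hκ i d 0 hd⟩
  have h1 := wtPow_le_cycPow m (hlim m f)
  have h2 := cycPow_mono (by omega : m ≤ 24 * n + 6 + m) (hs m).2
  have h3 := wtPow_le_cycPow m (wtPow_mono (by omega : m ≤ 24 * n + 6 + m)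
    (powerPart_sub_powerPart_mem (W := 24 * n + 6 + m) fun i d hd => (hκ i d m hd).symm))
  have := add_mem (add_mem h1 h2) h3
  refine (congrArg (· ∈ cycPow ℂ arrowWeight m) ?_).mp this
  rw [monomialPotential_eq, monomialPotential_eq]
  abel

end Elementary

/-! ### Normalization of the degree-two part. -/

section Monomialization

variable {n : ℕ} {I : Finset (Fin n)}

open Classical in
/-- The term `x_i' x_j`, if `j` is the successor of `i`. -/
noncomputable def adjTerm (p : QIndex n I × QIndex n I) : CompletePathAlgebra ℂ (QVertex n I) :=
  if p.1.IsNext p.2 then p.1.x' * p.2.x else 0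

open Classical in
/-- The term `x_i' x_j`, if `i` and `j` are the two edges at a vertex with a loop. -/
noncomputable def skipTerm (p : QIndex n I × QIndex n I) : CompletePathAlgebra ℂ (QVertex n I) :=
  if Skip p.1 p.2 then p.1.x' * p.2.x else 0

/-- The term `x_i ^ 2`, if `i` is an edge. -/
noncomputable def squareTerm (i : QIndex n I) : CompletePathAlgebra ℂ (QVertex n I) :=
  if i.xPath.length = 2 then i.x ^ 2 else 0

theorem length_xPath (i : QIndex n I) : i.xPath.length = 1 ∨ i.xPath.length = 2 := by
  cases i with
  | loop v hv => exact Or.inl rfl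
  | edge v w h => exact Or.inr rfl

theorem leading_eq_sum : leading n I = ∑ p : QIndex n I × QIndex n I, adjTerm p := by
  classical
  rw [Fintype.sum_prod_type]
  rfl

/-- Source of the threshold 24n + 6 = 3(8n + 2): cycles of degree two weigh at most 24n, those of
degree three or more at least 24n + 6. -/
theorem degree_bounds {u : QVertex n I} (c : Quiver.Path u u) :
    (8 * n + 2) * qDegree c ≤ wt c ∧ wt c ≤ (12 * n) * qDegree c := by
  have h1 := degree_le_wt c
  have h2 := wt_le_degree c
  constructor
  · nlinarith
  · nlinarith

theorem degree_eq_two_of_wt {u : QVertex n I} {c : Quiver.Path u u} {i j : QIndex n I}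
    (h : wt c = i.xWeight + j.xWeight) : qDegree c = 2 := by
  obtain ⟨h1, h2⟩ := degree_bounds c
  have hi := xWeight_le i
  have hj := xWeight_le j
  have hi' : 8 * n + 2 ≤ i.xWeight := by rw [xWeight]; omega
  have hj' : 8 * n + 2 ≤ j.xWeight := by rw [xWeight]; omega
  rcases lt_trichotomy (qDegree c) 2 with h3 | h3 | h3
  · have : (12 * n) * qDegree c ≤ (12 * n) * 1 := Nat.mul_le_mul_left _ (by omega)
    omega
  · exact h3
  · have : (8 * n + 2) * 3 ≤ (8 * n + 2) * qDegree c := Nat.mul_le_mul_left _ h3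
    omega

/-- The terms of degree two of a reduced potential, up to cyclic equivalence. -/
theorem exists_degree_two_part {f : CompletePathAlgebra ℂ (QVertex n I)} (hpot : IsPotential f)
    (hred : IsReduced f)
    (hdeg : ∀ (v w : QVertex n I) (p : Quiver.Path v w), f v w p ≠ 0 → 2 ≤ qDegree p) :
    ∃ (c d : QIndex n I × QIndex n I → ℂ) (κ : QIndex n I → ℂ),
      f - (∑ p, c p • adjTerm p + ∑ i, κ i • squareTerm i + ∑ p, d p • skipTerm p) ∈
        cycPow ℂ arrowWeight (24 * n + 6) := by
  classical
  let N := Submodule.span ℂ (Set.range (adjTerm (n := n) (I := I))) ⊔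
    Submodule.span ℂ (Set.range (squareTerm (n := n) (I := I))) ⊔
    Submodule.span ℂ (Set.range (skipTerm (n := n) (I := I))) ⊔
    cycPow ℂ arrowWeight (24 * n + 6)
  have hcyc : cycPow ℂ arrowWeight (24 * n + 6) ≤ N := le_sup_right
  have hadj : ∀ p, adjTerm p ∈ N := fun p => (le_sup_left.trans (le_sup_left.trans le_sup_left) :
    Submodule.span ℂ (Set.range adjTerm) ≤ N) (Submodule.subset_span ⟨p, rfl⟩)
  have hsq : ∀ p, squareTerm p ∈ N := fun p => (le_sup_right.trans (le_sup_left.trans le_sup_left) :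
    Submodule.span ℂ (Set.range squareTerm) ≤ N) (Submodule.subset_span ⟨p, rfl⟩)
  have hskip : ∀ p, skipTerm p ∈ N := fun p => (le_sup_right.trans le_sup_left :
    Submodule.span ℂ (Set.range skipTerm) ≤ N) (Submodule.subset_span ⟨p, rfl⟩)
  have hterm : ∀ {u v : QVertex n I} (p : Quiver.Path u v), f u v p ≠ 0 → wt p < 24 * n + 6 →
      ofPath ℂ p ∈ N := by
    intro u v p hp hw
    obtain rfl := hpot u v p hp
    have h2 := hdeg _ _ p hp
    have hb := (degree_bounds p).1
    have hd : qDegree p = 2 := by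
      by_contra hne
      have : (8 * n + 2) * 3 ≤ (8 * n + 2) * qDegree p := Nat.mul_le_mul_left _ (by omega)
      omega
    have hl : p.length ≠ 2 := fun h => hp (hred _ _ p h)
    have close : ∀ {t : CompletePathAlgebra ℂ (QVertex n I)}, t ∈ N →
        ofPath ℂ p - t ∈ commutators ℂ (QVertex n I) → ofPath ℂ p ∈ N := by
      intro t ht h
      have := add_mem (hcyc (commutators_le_cycPow _ h)) ht
      rwa [sub_add_cancel] at this
    rcases cycle_of_degree_two p hd with ⟨i, j, hij, h⟩ | ⟨i, h, hlen⟩ | ⟨i, j, hij, h⟩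
    · have := hadj (i, j)
      rw [adjTerm, if_pos (isNext_iff_adj.2 hij)] at this
      exact close this h
    · have := hsq i
      rw [squareTerm, if_pos (by rcases length_xPath i with h | h <;> omega)] at this
      exact close this h
    · have := hskip (i, j)
      rw [skipTerm, if_pos hij] at this
      exact close this h
  have hf : f ∈ N := by
    rw [← sub_add_cancel f (trunc one_le_arrowWeight (24 * n + 6) f)]
    refine add_mem (hcyc (wtPow_le_cycPow _ (sub_trunc_mem one_le_arrowWeight _ f))) ?_
    refine Submodule.sum_mem _ fun P hP => ?_
    by_cases h0 : f P.1 P.2.1 P.2.2 = 0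
    · rw [h0, zero_smul]
      exact zero_mem _
    · exact Submodule.smul_mem _ _ (hterm _ h0 ((mem_pathsBelow one_le_arrowWeight).1 hP))
  obtain ⟨y, hy, r, hr, rfl⟩ := Submodule.mem_sup.1 hf
  obtain ⟨z, hz, y₃, h₃, rfl⟩ := Submodule.mem_sup.1 hy
  obtain ⟨y₁, h₁, y₂, h₂, rfl⟩ := Submodule.mem_sup.1 hz
  obtain ⟨c, rfl⟩ := (Submodule.mem_span_range_iff_exists_fun ℂ).1 h₁
  obtain ⟨κ, rfl⟩ := (Submodule.mem_span_range_iff_exists_fun ℂ).1 h₂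
  obtain ⟨d, rfl⟩ := (Submodule.mem_span_range_iff_exists_fun ℂ).1 h₃
  refine ⟨c, d, κ, ?_⟩
  rwa [add_sub_cancel_left]

theorem cycleSum_x'_mul_x {i j k l : QIndex n I} (h : k.tgt = l.src) :
    cycleSum one_le_arrowWeight (i.xWeight + j.xWeight) (k.x' * l.x) =
      if i.xWeight + j.xWeight = k.xWeight + l.xWeight then (1 : ℂ) else 0 := by
  obtain ⟨q, hq, hw, -⟩ := exists_path_x'_mul_x h
  rw [← hq]
  split_ifs with e
  · rw [e, ← hw]
    exact cycleSum_ofPath one_le_arrowWeight q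
  · exact cycleSum_ofPath_of_ne one_le_arrowWeight q fun e' => e (e'.symm.trans hw)

/-- The weight of x_i' x_j is shared by no other adjacent pair, square or skip term, so the trace at
that weight isolates one coefficient. -/
theorem cycleSum_degree_two_part {f : CompletePathAlgebra ℂ (QVertex n I)}
    {c d : QIndex n I × QIndex n I → ℂ} {κ : QIndex n I → ℂ}
    (hf : f - (∑ p, c p • adjTerm p + ∑ i, κ i • squareTerm i + ∑ p, d p • skipTerm p) ∈
        cycPow ℂ arrowWeight (24 * n + 6)) {i j : QIndex n I} (hij : Adj i j) :
    cycleSum one_le_arrowWeight (i.xWeight + j.xWeight) f = c (i, j) := by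
  have hi := xWeight_le i
  have hj := xWeight_le j
  have h0 := cycleSum_eq_zero_of_mem_cycPow one_le_arrowWeight
    (by omega : i.xWeight + j.xWeight < 24 * n + 6) hf
  rw [map_sub, sub_eq_zero] at h0
  rw [h0, map_add, map_add, map_sum, map_sum, map_sum, Finset.sum_eq_single (i, j)]
  · rw [map_smul, adjTerm, if_pos (isNext_iff_adj.2 hij), cycleSum_x'_mul_x hij.tgt_eq_src,
      if_pos rfl, smul_eq_mul, mul_one, Finset.sum_eq_zero, Finset.sum_eq_zero, add_zero, add_zero]
    · rintro ⟨k, l⟩ -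
      rw [map_smul, skipTerm]
      split_ifs with hkl
      · rw [cycleSum_x'_mul_x hkl.tgt_eq_src, if_neg (hij.xWeight_add_ne_skip hkl), smul_zero]
      · rw [map_zero, smul_zero]
    · intro k _
      rw [map_smul, squareTerm]
      split_ifs with hk
      · obtain ⟨q, hq, hw, -⟩ := exists_path_x_pow k 1
        rw [← hq, cycleSum_ofPath_of_ne one_le_arrowWeight q, smul_zero]
        intro e
        exact hij.xWeight_add_ne_two_mul k (e.symm.trans hw)
      · rw [map_zero, smul_zero]
  · rintro ⟨k, l⟩ - hne
    rw [map_smul, adjTerm]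
    split_ifs with hkl
    · have hkl := isNext_iff_adj.1 hkl
      rw [cycleSum_x'_mul_x hkl.tgt_eq_src, if_neg, smul_zero]
      intro e
      obtain ⟨rfl, rfl⟩ := hij.eq_of_xWeight_add hkl e
      exact hne rfl
    · rw [map_zero, smul_zero]
  · exact fun h => absurd (Finset.mem_univ _) h

/-- A cycle of this weight occurring in the complement `h` would have degree two, hence be a
rotation of x_i' x_j and lie in both cycle spans, against orthogonality. So the trace sees only the
nonzero scalar. -/
theorem cycleSum_ne_zero_of_contains {f : CompletePathAlgebra ℂ (QVertex n I)} {i j : QIndex n I}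
    (hij : Adj i j) (hf : Contains f (i.x' * j.x)) :
    cycleSum one_le_arrowWeight (i.xWeight + j.xWeight) f ≠ 0 := by
  obtain ⟨r, h, hr, -, hfh, horth⟩ := hf
  obtain ⟨q, hq, hqw, -⟩ := exists_path_x'_mul_x hij.tgt_eq_src
  have h0 := cycleSum_eq_zero_of_mem_cycPow one_le_arrowWeight
    (Nat.lt_succ_self (i.xWeight + j.xWeight)) (hfh.mem_cycPow one_le_arrowWeight _)
  have hh : cycleSum one_le_arrowWeight (i.xWeight + j.xWeight) h = 0 := by
    refine cycleSum_eq_zero one_le_arrowWeight fun u p hp => ?_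
    by_contra hne
    have hpq : ofPath ℂ p - ofPath ℂ q ∈ commutators ℂ (QVertex n I) := by
      rcases cycle_of_degree_two p (degree_eq_two_of_wt hp) with
        ⟨k, l, hkl, e⟩ | ⟨k, e, -⟩ | ⟨k, l, hkl, e⟩
      · obtain ⟨q', hq', hw', -⟩ := exists_path_x'_mul_x hkl.tgt_eq_src
        have := pathWt_eq_of_sub_mem_commutators one_le_arrowWeight (hq' ▸ e)
        obtain ⟨rfl, rfl⟩ := hij.eq_of_xWeight_add hkl (hp.symm.trans (this.trans hw'))
        rwa [hq]
      · obtain ⟨q', hq', hw', -⟩ := exists_path_x_pow k 1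
        have := pathWt_eq_of_sub_mem_commutators one_le_arrowWeight (hq' ▸ e)
        exact absurd (hp.symm.trans (this.trans hw')) (hij.xWeight_add_ne_two_mul k)
      · obtain ⟨q', hq', hw', -⟩ := exists_path_x'_mul_x hkl.tgt_eq_src
        have := pathWt_eq_of_sub_mem_commutators one_le_arrowWeight (hq' ▸ e)
        exact absurd (hp.symm.trans (this.trans hw')) (hij.xWeight_add_ne_skip hkl)
    have h1 : ofPath ℂ p ∈ cycleSpan (r • (i.x' * j.x)) := by
      refine Submodule.subset_span ⟨u, _, p, q, rfl, ?_, fun m => ⟨_, hpq, ?_⟩⟩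
      · rw [← hq, smul_coeff, ofPath_self, mul_one]
        exact hr
      · rw [sub_self]
        exact zero_mem _
    have h2 : ofPath ℂ p ∈ cycleSpan h :=
      Submodule.subset_span ⟨u, u, p, p, rfl, hne, (CycRel.refl p).cycEquiv⟩
    have h3 : ofPath ℂ p ∈ (⊥ : Submodule ℂ (CompletePathAlgebra ℂ (QVertex n I))) :=
      horth ▸ Submodule.mem_inf.2 ⟨h1, h2⟩
    have h4 : ofPath ℂ p u u p = 0 := by rw [(Submodule.mem_bot ℂ).1 h3, zero_coeff]
    rw [ofPath_self] at h4
    exact one_ne_zero h4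
  rw [map_sub, map_add, map_smul, hh, cycleSum_x'_mul_x hij.tgt_eq_src, if_pos rfl, add_zero,
    smul_eq_mul, mul_one, sub_eq_zero] at h0
  rwa [h0]

/-- The indices form a chain: each `j` has at most one predecessor, so the equations are solved from
left to right, each determining s_j from s_i. -/
theorem exists_scaling (c : QIndex n I × QIndex n I → ℂ) (hc : ∀ i j, Adj i j → c (i, j) ≠ 0) :
    ∃ s : QIndex n I → ℂˣ, ∀ i j, Adj i j → (s i : ℂ) * s j * c (i, j) = 1 := by
  classical
  have key : ∀ N : ℕ, ∃ s : QIndex n I → ℂˣ,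
      ∀ i j, Adj i j → j.pos < N → (s i : ℂ) * s j * c (i, j) = 1 := by
    intro N
    induction N with
    | zero => exact ⟨fun _ => 1, fun i j _ h => absurd h (Nat.not_lt_zero _)⟩
    | succ N ih =>
      obtain ⟨s, hs⟩ := ih
      refine ⟨fun j => if j.pos = N then
        (if h : ∃ i, Adj i j then (s h.choose * Units.mk0 _ (hc _ _ h.choose_spec))⁻¹ else 1)
        else s j, fun i j hij hj => ?_⟩
      have hi : i.pos ≠ N := by
        have := hij.pos_lt_pos
        omega
      simp only [if_neg hi]
      by_cases hjN : j.pos = N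
      · have hex : ∃ i, Adj i j := ⟨i, hij⟩
        rw [if_pos hjN, dif_pos hex]
        obtain rfl := hij.left_unique hex.choose_spec
        rw [mul_right_comm, Units.val_inv_eq_inv_val, Units.val_mul, Units.val_mk0]
        exact mul_inv_cancel₀ (mul_ne_zero (Units.ne_zero _) (hc _ _ hij))
      · rw [if_neg hjN]
        exact hs i j hij (by omega)
  obtain ⟨s, hs⟩ := key (2 * n)
  exact ⟨s, fun i j hij => hs i j hij (by have := j.pos_lt; omega)⟩

/-- The scaling of the arrows `a_i`. -/
def arrowScale (s : QIndex n I → ℂˣ) : ∀ v w : QVertex n I, (v ⟶ w) → ℂˣ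
  | _, _, QArrow.loop v hv => s (loop v hv)
  | _, _, QArrow.right v w h => s (edge v w h)
  | _, _, QArrow.left _ _ _ => 1

theorem scale_a (s : QIndex n I → ℂˣ) (i : QIndex n I) :
    scale (arrowScale s) i.a = (s i : ℂ) • i.a := by
  cases i with
  | loop v hv => exact scale_ofArrow _ _
  | edge v w h => exact scale_ofArrow _ _

theorem scale_b (s : QIndex n I → ℂˣ) (i : QIndex n I) : scale (arrowScale s) i.b = i.b := by
  cases i with
  | loop v hv => exact scale_idem _ _
  | edge v w h => exact (scale_ofArrow _ _).trans (one_smul _ _)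

theorem scale_x (s : QIndex n I → ℂˣ) (i : QIndex n I) :
    scale (arrowScale s) i.x = (s i : ℂ) • i.x := by
  rw [x, map_mul, scale_a, scale_b, smul_mul_assoc]

theorem scale_x' (s : QIndex n I → ℂˣ) (i : QIndex n I) :
    scale (arrowScale s) i.x' = (s i : ℂ) • i.x' := by
  rw [x', map_mul, scale_a, scale_b, mul_smul_comm]

theorem scale_adjTerm (s : QIndex n I → ℂˣ) (p : QIndex n I × QIndex n I) :
    scale (arrowScale s) (adjTerm p) = ((s p.1 : ℂ) * s p.2) • adjTerm p := by
  rw [adjTerm]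
  split_ifs
  · rw [map_mul, scale_x, scale_x', smul_mul_smul_comm]
  · rw [map_zero, smul_zero]

theorem scale_skipTerm (s : QIndex n I → ℂˣ) (p : QIndex n I × QIndex n I) :
    scale (arrowScale s) (skipTerm p) = ((s p.1 : ℂ) * s p.2) • skipTerm p := by
  rw [skipTerm]
  split_ifs
  · rw [map_mul, scale_x, scale_x', smul_mul_smul_comm]
  · rw [map_zero, smul_zero]

theorem scale_squareTerm (s : QIndex n I → ℂˣ) (i : QIndex n I) :
    scale (arrowScale s) (squareTerm i) = ((s i : ℂ) ^ 2) • squareTerm i := by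
  rw [squareTerm]
  split_ifs
  · rw [map_pow, scale_x, smul_pow]
  · rw [map_zero, smul_zero]

theorem exists_scaled {f : CompletePathAlgebra ℂ (QVertex n I)}
    {c d : QIndex n I × QIndex n I → ℂ} {κ : QIndex n I → ℂ}
    (hf : f - (∑ p, c p • adjTerm p + ∑ i, κ i • squareTerm i + ∑ p, d p • skipTerm p) ∈
        cycPow ℂ arrowWeight (24 * n + 6)) (hc : ∀ i j, Adj i j → c (i, j) ≠ 0) :
    ∃ (s : QIndex n I → ℂˣ) (d' : QIndex n I × QIndex n I → ℂ) (κ' : QIndex n I → ℂ),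
      scale (arrowScale s) f -
        (leading n I + ∑ i, κ' i • squareTerm i + ∑ p, d' p • skipTerm p) ∈
        cycPow ℂ arrowWeight (24 * n + 6) := by
  obtain ⟨s, hs⟩ := exists_scaling c hc
  refine ⟨s, fun p => d p * (s p.1 * s p.2), fun i => κ i * s i ^ 2, ?_⟩
  have h := map_mem_cycPow (scale (arrowScale s)).toAlgHom
    (fun g hg => scale_mem_wtPow (arrowScale s) hg) hf
  refine (congrArg (· ∈ cycPow ℂ arrowWeight (24 * n + 6)) ?_).mp h
  change scale (arrowScale s) _ = _
  have hadj : ∀ p : QIndex n I × QIndex n I,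
      scale (arrowScale s) (c p • adjTerm p) = adjTerm p := by
    intro p
    rw [map_smul, scale_adjTerm, smul_smul]
    by_cases hp : p.1.IsNext p.2
    · rw [mul_comm, hs _ _ (isNext_iff_adj.1 hp), one_smul]
    · rw [adjTerm, if_neg hp, smul_zero]
  simp only [map_sub, map_add, map_sum, hadj, leading_eq_sum]
  simp only [map_smul, scale_squareTerm, scale_skipTerm, smul_smul]

-- At the loop j between the edges i and k, the substitution a_j ↦ a_j - r x_k turns x_i' a_j + a_j
-- x_k into itself minus r x_i' x_k and r x_k ^ 2. The square is absorbed into the coefficient of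
-- the edge k. No other term contains a_j, since `squareTerm` omits loops; thus the identity is
-- exact.
open Classical in
theorem exists_remove_skip (κ : QIndex n I → ℂ) (p : QIndex n I × QIndex n I) (r : ℂ) :
    ∃ (ρ : CompletePathAlgebra ℂ (QVertex n I) →ₐ[ℂ] CompletePathAlgebra ℂ (QVertex n I))
      (κ' : QIndex n I → ℂ), RaisesBy arrowWeight 1 ρ ∧
      ρ (leading n I + ∑ i, κ i • squareTerm i + r • skipTerm p) =
        leading n I + ∑ i, κ' i • squareTerm i ∧ ∀ q, ρ (skipTerm q) = skipTerm q := by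
  by_cases hp : Skip p.1 p.2
  swap
  · refine ⟨AlgHom.id ℂ _, κ, RaisesBy.id 1, ?_, fun _ => rfl⟩
    rw [skipTerm, if_neg hp, smul_zero, add_zero]
    rfl
  obtain ⟨i, k⟩ := p
  rw [skipTerm, if_pos hp]
  obtain ⟨u, v, w, h, h', hv⟩ := hp
  dsimp only
  set j : QIndex n I := loop v hv with hj
  set i : QIndex n I := edge u v h with hi
  set k : QIndex n I := edge v w h' with hk
  have hil : idem ℂ v * k.x = k.x := by
    rw [← ofPath_xPath]
    exact idem_mul_ofPath _
  have hir : k.x * idem ℂ v = k.x := by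
    rw [← ofPath_xPath]
    exact ofPath_mul_idem _
  obtain ⟨ρ, hρ, hja, hne, hb⟩ := exists_elementary j 1 ((-r) • k.x)
    (by rw [mul_smul_comm]; exact congrArg _ hil) (by rw [smul_mul_assoc]; exact congrArg _ hir)
    (Submodule.smul_mem _ _ (wtPow_mono (by
      have e := wt_aPath_add_wt_bPath j
      have e1 : j.xWeight = 2 * (4 * n + 1 + 2 * v.num.val) := rfl
      have e2 : k.xWeight = 2 * (4 * n + 1 + (2 * v.num.val + 1)) := rfl
      omega) k.x_mem_wtPow))
  have hij : Adj i j := Adj.edgeLoop u v h hv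
  have hjk : Adj j k := Adj.loopEdge v w hv h'
  have hsq : ∀ l, ρ (squareTerm l) = squareTerm l := by
    intro l
    rw [squareTerm]
    split_ifs with hl
    · have hlj : l ≠ j := by
        rintro rfl
        exact Nat.succ_ne_self 1 hl.symm
      rw [map_pow, elementary_x hne hb hlj]
    · rw [map_zero]
  have hskip : ∀ q, ρ (skipTerm q) = skipTerm q := by
    rintro ⟨l, m⟩
    rw [skipTerm]
    split_ifs with hlm
    · have hl : l ≠ j ∧ m ≠ j := by
        obtain ⟨u', v', w', hu', hw', hv'⟩ := hlm
        exact ⟨by rw [hj]; exact nofun, by rw [hj]; exact nofun⟩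
      rw [map_mul, elementary_x hne hb hl.2, elementary_x' hne hb hl.1]
    · rw [map_zero]
  have hlead : ρ (leading n I) = leading n I - r • (i.x' * k.x) - r • k.x ^ 2 := by
    rw [elementary_leading hja hne hb hij, Finset.sum_eq_single k,
      if_pos (isNext_iff_adj.2 hjk)]
    · have e1 : (-r) • k.x * j.b = (-r) • k.x := by
        rw [smul_mul_assoc]
        exact congrArg _ hir
      have e2 : j.b * (-r) • k.x = (-r) • k.x := by
        rw [mul_smul_comm]
        exact congrArg _ hil
      rw [e1, e2, mul_smul_comm, smul_mul_assoc, neg_smul, neg_smul, sq]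
      abel
    · intro l _ hl
      exact if_neg fun hjl => hl ((isNext_iff_adj.1 hjl).right_unique hjk)
    · exact fun h => absurd (Finset.mem_univ k) h
  have hik : ρ (i.x' * k.x) = i.x' * k.x := by
    have := hskip (i, k)
    rwa [skipTerm, if_pos (Skip.mk u v w h h' hv)] at this
  refine ⟨ρ, fun l => κ l - if l = k then r else 0, hρ, ?_, hskip⟩
  have hk2 : ∑ l, (if l = k then r else 0) • squareTerm l = r • k.x ^ 2 := by
    have hk1 : k.xPath.length = 2 := rfl
    rw [Finset.sum_eq_single k, if_pos rfl, squareTerm, if_pos hk1]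
    · intro l _ hl
      rw [if_neg hl, zero_smul]
    · exact fun h => absurd (Finset.mem_univ k) h
  simp only [map_add, map_sum, map_smul, hsq, sub_smul, Finset.sum_sub_distrib]
  rw [hlead, hk2, hik]
  abel

/-- Each removal fixes all other skip terms but alters the square coefficients, so the induction is
uniform in `κ`. -/
theorem exists_remove_skips (d : QIndex n I × QIndex n I → ℂ)
    (S : Finset (QIndex n I × QIndex n I)) : ∀ κ : QIndex n I → ℂ,
    ∃ (ρ : CompletePathAlgebra ℂ (QVertex n I) →ₐ[ℂ] CompletePathAlgebra ℂ (QVertex n I))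
      (κ' : QIndex n I → ℂ), RaisesBy arrowWeight 1 ρ ∧
      ρ (leading n I + ∑ i, κ i • squareTerm i + ∑ p ∈ S, d p • skipTerm p) =
        leading n I + ∑ i, κ' i • squareTerm i := by
  classical
  induction S using Finset.induction_on with
  | empty =>
    intro κ
    refine ⟨AlgHom.id ℂ _, κ, RaisesBy.id 1, ?_⟩
    rw [Finset.sum_empty, add_zero]
    rfl
  | insert p S hp ih =>
    intro κ
    obtain ⟨ρ₁, κ₁, hρ₁, h₁, hfix⟩ := exists_remove_skip κ p (d p)
    obtain ⟨ρ₂, κ₂, hρ₂, h₂⟩ := ih κ₁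
    refine ⟨ρ₂.comp ρ₁, κ₂, hρ₂.comp hρ₁, ?_⟩
    rw [Finset.sum_insert hp, ← add_assoc, AlgHom.comp_apply, map_add ρ₁, h₁, ← h₂]
    simp only [map_sum ρ₁, map_smul, hfix]

theorem powerPart_squares_mem (κ : QIndex n I → ℂ) :
    powerPart (fun i m => if m = 2 ∧ i.xPath.length = 2 then κ i else 0) -
      ∑ i, κ i • squareTerm i ∈ wtPow ℂ arrowWeight (24 * n + 6) := by
  have h := powerPart_sub_mem (fun (i : QIndex n I) (m : ℕ) =>
    if m = 2 ∧ i.xPath.length = 2 then κ i else 0) (24 * n + 6)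
  have e : ∀ i : QIndex n I, ∑ m ∈ Finset.Icc 2 (24 * n + 6),
      (if m = 2 ∧ i.xPath.length = 2 then κ i else 0) • i.x ^ m = κ i • squareTerm i := by
    intro i
    rw [Finset.sum_eq_single 2, squareTerm]
    · by_cases hi : i.xPath.length = 2
      · rw [if_pos ⟨rfl, hi⟩, if_pos hi]
      · rw [if_neg (fun h => hi h.2), if_neg hi, zero_smul, smul_zero]
    · intro m _ hm
      rw [if_neg (fun h => hm h.1), zero_smul]
    · intro h
      exact absurd (Finset.mem_Icc.2 ⟨le_rfl, by omega⟩) h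
  simp only [e] at h
  exact wtPow_mono (Nat.le_succ _) h

theorem isPotential_monomialPotential (κ : QIndex n I → ℕ → ℂ) :
    IsPotential (monomialPotential κ) := by
  intro u v p hp
  by_contra huv
  have hclosed : ∀ {w : QVertex n I} (q : Quiver.Path w w), ofPath ℂ q u v p = 0 := by
    intro w q
    refine ofPath_of_ne _ _ fun e => huv ?_
    cases e
    rfl
  apply hp
  rw [monomialPotential_eq, add_coeff, leading_eq_sum, powerPart, sum_coeff, sum_coeff,
    Finset.sum_eq_zero, Finset.sum_eq_zero, add_zero]
  · intro i _
    rw [seriesFromTwo_coeff _ i p le_rfl]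
    refine Finset.sum_eq_zero fun m hm => ?_
    obtain ⟨l, rfl⟩ := Nat.exists_eq_add_of_le (Finset.mem_Icc.1 hm).1
    obtain ⟨q, hq, -⟩ := exists_path_x_pow i (l + 1)
    rw [show 2 + l = l + 1 + 1 by omega, ← hq, hclosed, mul_zero]
  · rintro ⟨i, j⟩ -
    rw [adjTerm]
    split_ifs with hij
    · obtain ⟨q, hq, -⟩ := exists_path_x'_mul_x (isNext_iff_adj.1 hij).tgt_eq_src
      rw [← hq, hclosed]
    · rfl

/-- Two loops are never adjacent, so x_i' x_j has length 3 or 4. Only squares of loops have length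
two, and their coefficients vanish by hypothesis. -/
theorem isReduced_monomialPotential {κ : QIndex n I → ℕ → ℂ}
    (hκ : ∀ i : QIndex n I, i.xPath.length ≠ 2 → κ i 2 = 0) :
    IsReduced (monomialPotential κ) := by
  intro u v p hp
  have hlong : ∀ {w : QVertex n I} (q : Quiver.Path w w), q.length ≠ 2 →
      ofPath ℂ q u v p = 0 := by
    intro w q hq
    refine ofPath_of_ne _ _ fun e => hq ?_
    cases e
    exact hp
  rw [monomialPotential_eq, add_coeff, leading_eq_sum, powerPart, sum_coeff, sum_coeff,
    Finset.sum_eq_zero, Finset.sum_eq_zero, add_zero]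
  · intro i _
    rw [seriesFromTwo_coeff _ i p hp.le, Finset.Icc_self, Finset.sum_singleton]
    by_cases hi : i.xPath.length = 2
    · obtain ⟨q, hq, -, hl⟩ := exists_path_x_pow i 1
      have hq' : ofPath ℂ q = i.x ^ 2 := hq
      rw [← hq', hlong q (by omega), mul_zero]
    · rw [hκ i hi, zero_mul]
  · rintro ⟨i, j⟩ -
    rw [adjTerm]
    split_ifs with hij
    · obtain ⟨q, hq, -, hl⟩ := exists_path_x'_mul_x (isNext_iff_adj.1 hij).tgt_eq_src
      rw [← hq, hlong q]
      have h3 : i.x'Path.length + j.xPath.length ≠ 2 := by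
        cases isNext_iff_adj.1 hij with
        | loopEdge v w hv h => exact (by decide : 1 + 2 ≠ 2)
        | edgeLoop v w h hv => exact (by decide : 2 + 1 ≠ 2)
        | edgeEdge u v w h h' hv => exact (by decide : 2 + 2 ≠ 2)
      rwa [hl]
    · rfl

end Monomialization

/-! ### Conclusion: scaling, removal of skip terms, then monomialization. -/

theorem theorem4p7 (n : ℕ) (I : Finset (Fin n)) (f : CompletePathAlgebra ℂ (QVertex n I))
    (hf : IsReducedTypeA f) :
    ∃ (f' : CompletePathAlgebra ℂ (QVertex n I))
      (ρ : CompletePathAlgebra ℂ (QVertex n I) ≃ₐ[ℂ] CompletePathAlgebra ℂ (QVertex n I)),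
      CompletePathAlgebra.IsRightEquivalence ρ f f' ∧
        CompletePathAlgebra.IsReduced f' ∧ IsMonomializedTypeA f' := by
  obtain ⟨hpot, hred, hdeg, hcont⟩ := hf
  obtain ⟨c, d, κ, h⟩ := exists_degree_two_part hpot hred hdeg
  have hc : ∀ i j, Adj i j → c (i, j) ≠ 0 := by
    intro i j hij
    rw [← cycleSum_degree_two_part h hij]
    exact cycleSum_ne_zero_of_contains hij (hcont i j (isNext_iff_adj.2 hij))
  obtain ⟨s, d, κ, h⟩ := exists_scaled h hc
  obtain ⟨ρ₁, κ, hρ₁, e⟩ := exists_remove_skips d Finset.univ κ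
  let κ₀ : QIndex n I → ℕ → ℂ := fun i m => if m = 2 ∧ i.xPath.length = 2 then κ i else 0
  have h₀ : ρ₁ (scale (arrowScale s) f) - monomialPotential κ₀ ∈
      cycPow ℂ arrowWeight (24 * n + 6) := by
    have h1 := map_mem_cycPow ρ₁ (fun g hg => hρ₁.mem hg) h
    rw [map_sub, e] at h1
    have h2 := wtPow_le_cycPow (24 * n + 6) (powerPart_squares_mem κ)
    refine (congrArg (· ∈ cycPow ℂ arrowWeight (24 * n + 6)) ?_).mp (sub_mem h1 h2)
    rw [monomialPotential_eq]
    abel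
  obtain ⟨ρ₂, κ', hρ₂, hequiv, hκ⟩ := exists_monomialization _ κ₀ h₀
  refine ⟨monomialPotential κ', ((scale (arrowScale s)).trans
    (AlgEquiv.ofBijective ρ₁ hρ₁.bijective)).trans (AlgEquiv.ofBijective ρ₂ hρ₂.bijective),
    ⟨fun v => ?_, hequiv⟩, isReduced_monomialPotential fun i hi => ?_,
    isPotential_monomialPotential κ', κ', fun m => ⟨0, zero_mem _, ?_⟩⟩
  · change ρ₂ (ρ₁ (scale (arrowScale s) (idem ℂ v))) = idem ℂ v
    rw [scale_idem, hρ₁.idem, hρ₂.idem]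
  -- Squares weigh at most 24n - 4, below the range altered by `ρ₂`; hence no square of a loop has
  -- reappeared.
  · rw [hκ i 2 (by have := xWeight_le i; omega)]
    exact if_neg fun h => hi h.2
  · rw [sub_self, sub_zero]
    exact zero_mem _
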